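/- Let $\mathbb{R}^{n\times m}$ ($n\le m$) and $\mathbb{S}^n$ (real symmetric $n\times n$ matrices) carry the trace inner product $\langle A,B\rangle=\mathrm{tr}(A^{\mathsf T}B)$ and the Frobenius norm $\|\cdot\|_F$; let $\mathbb{X}$ be $\mathbb{R}^{n\times m}$ or $\mathbb{S}^n$, and let $\mathbb{S}^n_+\subset\mathbb{S}^n$ be the positive semidefinite cone. Let $r\in\{1,\dots,n\}$. For closed $\Omega\subseteq\mathbb{X}$ put $\Gamma_r=\{X\in\Omega:\operatorname{rank}X\le r\}$, $\Lambda_r=\{X\in\mathbb{X}:\operatorname{rank}X\le r\}$, $\Lambda_r^+=\{X\in\mathbb{S}^n_+:\operatorname{rank}X\le r\}$ and $$\mathcal S_r(\tau)=\{X\in\Omega:\ \|X\|_*-\|X\|_{(r)}=\tau\}\qquad(\tau\in\mathbb{R}),$$ where $\|X\|_*$ is the sum of all singular values of $X$ and $\|X\|_{(r)}$ the sum of the $r$ largest ones. For a set $S$ and $\bar x\in S$, the regular normal cone $\widehat{\mathcal N}_S(\bar x)$ is the set of $v$ with $\limsup_{x\to\bar x,\,x\in S\setminus\{\bar x\}}\langle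 v,x-\bar x\rangle/\|x-\bar x\|\le 0$, and the limiting normal cone $\mathcal N_S(\bar x)$ is the set of limits of sequences $v^k\in\widehat{\mathcal N}_S(x^k)$ with $x^k\in S$, $x^k\to\bar x$; normal cones are taken in the ambient space $\mathbb{X}$ (respectively $\mathbb{S}^n$). $\mathcal S_r$ is calm at $0$ for $\bar X\in\mathcal S_r(0)$ if there are $\gamma\ge0$ and $\varepsilon,\delta>0$ such that, for all $|\tau|\le\varepsilon$, $\mathcal S_r(\tau)\cap\{X:\|X-\bar X\|_F\le\delta\}\subseteq\mathcal S_r(0)+\gamma|\tau|\{Z:\|Z\|_F\le1\}$. Consider the two criteria $$(\mathrm{C1})\quad[-\mathcal N_\Omega(\bar X)]\cap\mathcal N_{\Lambda_r}(\bar X)=\{0\},\qquad(\mathrm{C2})\quad[-\mathcal N_\Xi(\bar X)]\cap\mathcal N_{\Lambda_r^+}(\bar X)=\{0\},$$ the second one for $\Omega=\mathbb{S}^n_+\cap\Xi$ with $\Xi\subseteq\mathbb{S}^n$ closed. In each of the following cases the indicated criterion holds at every $\bar X\in\Gamma_r$, and $\mathcal S_r$ is calm at $0$ for every $\bar X\in\mathcal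 S_r(0)$. Here $e$ is the all-ones vector. 1. (C1) for $\Omega=\{Z\in\mathbb{X}:|||Z|||\le\varrho\}$, where $\varrho>0$ and $|||\cdot|||$ is any norm on $\mathbb{X}$; (C1) for $\Omega=\{Z\in\mathbb{X}:\|Z\|_F=\varrho\}$, $\varrho>0$; both for $\mathbb{X}=\mathbb{R}^{n\times m}$ and for $\mathbb{X}=\mathbb{S}^n$. (C2) for $\Xi=\{Z\in\mathbb{S}^n:|||Z|||\le\varrho\}$, with $|||\cdot|||$ any norm on $\mathbb{S}^n$ and $\varrho>0$. 2. (C2) for $\Xi=\{X\in\mathbb{S}^n:\operatorname{diag}(X)=e\}$. 3. (C2) for $\Xi=\{X\in\mathbb{S}^n:\langle B,X\rangle=b_1,\ \langle C,X\rangle=b_2\}$, where $b_1\in\mathbb{R}$, $b_2\in\mathbb{R}\setminus\{0\}$, $B,C\in\mathbb{S}^n$ and $B-(b_1/b_2)C$ is nonsingular; and (C2) for $\Xi=\{X\in\mathbb{S}^n:\langle C,X\rangle=b_2\}$, where $b_2\neq0$ and $C\in\mathbb{S}^n$ is nonsingular. 4. (C2) for $\Xi=\{X\in\mathbb{S}^n:X_{11}=1,\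 X_{ii}-\tfrac12(X_{1i}+X_{i1})=0,\ i=2,\dots,n\}$. 5. (C2) for $n=kp$ and $\Xi=\{X\in\mathbb{S}^n:\langle I,X_{ii}\rangle=1,\ \langle I,X_{ij}\rangle=0\ (i\ne j\in\{1,\dots,k\})\}$, where $X_{ij}\in\mathbb{R}^{p\times p}$ is the $(i,j)$ block of $X$. 6. (C1), in $\mathbb{X}=\mathbb{R}^{n\times n}$, for $\Omega=\{X\in\mathbb{R}^{n\times n}:X\ge0\text{ entrywise},\ Xe=e\}$. 7. (C1), in $\mathbb{X}=\mathbb{R}^{n\times n}$, for $\Omega=\{X\in\mathbb{R}^{n\times n}:X\ge0\text{ entrywise},\ Xe=e,\ X^{\mathsf T}e=e\}$. -/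

import Mathlib

open Filter Topology
open scoped Pointwise Matrix Matrix.Norms.Frobenius

namespace RankCalm

noncomputable section

/-! ### Matrix spaces with the trace inner product -/

/-- The trace inner product `⟪A, B⟫ = tr (Aᵀ B)` on `ℝ^{n×m}`; its norm is the Frobenius norm. -/
instance traceInnerProductSpace (n m : ℕ) : InnerProductSpace ℝ (Matrix (Fin n) (Fin m) ℝ) where
  toNormedSpace := Matrix.frobeniusNormedSpace
  inner A B := (Aᵀ * B).trace
  norm_sq_eq_re_inner A := by
    have h : (0 : ℝ) ≤ ∑ i, ∑ j, A i j ^ 2 :=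
      Finset.sum_nonneg fun _ _ => Finset.sum_nonneg fun _ _ => sq_nonneg _
    have h2 : ‖A‖ ^ 2 = ∑ i, ∑ j, A i j ^ 2 := by
      rw [Matrix.frobenius_norm_def, ← Real.sqrt_eq_rpow]
      simp only [Real.rpow_two, Real.norm_eq_abs, sq_abs]
      exact Real.sq_sqrt h
    rw [h2, Finset.sum_comm]
    simp [Matrix.trace, Matrix.mul_apply, sq]
  conj_inner_symm A B := by
    simp [Matrix.trace, Matrix.mul_apply, mul_comm]
  add_left A B C := by
    simp [Matrix.add_mul]
  smul_left A B c := by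
    simp

/-- The space `ℝ^{n×m}` of all real `n × m` matrices. -/
abbrev FullSpace (n m : ℕ) : Submodule ℝ (Matrix (Fin n) (Fin m) ℝ) := ⊤

/-- The space `𝕊ⁿ` of real symmetric `n × n` matrices. -/
def SymSpace (n : ℕ) : Submodule ℝ (Matrix (Fin n) (Fin n) ℝ) where
  carrier := {A | A.IsSymm}
  add_mem' ha hb := Matrix.IsSymm.add ha hb
  zero_mem' := Matrix.isSymm_zero
  smul_mem' c _ ha := Matrix.IsSymm.smul ha c

/-! ### Calmness and normal cones -/

/-- `M` is calm at `y₀` for `z₀ ∈ M y₀`. -/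
def IsCalmAt {Y Z : Type*} [NormedAddCommGroup Y] [InnerProductSpace ℝ Y]
    [NormedAddCommGroup Z] [InnerProductSpace ℝ Z] (M : Y → Set Z) (y₀ : Y) (z₀ : Z) : Prop :=
  z₀ ∈ M y₀ ∧ ∃ γ : ℝ, 0 ≤ γ ∧ ∃ ε > 0, ∃ δ > 0, ∀ y ∈ Metric.closedBall y₀ ε,
    M y ∩ Metric.closedBall z₀ δ ⊆ M y₀ + (γ * ‖y - y₀‖) • Metric.closedBall (0 : Z) 1

/-- The Fréchet (regular) normal cone to `S` at `x₀`. -/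
def regularNormalCone {E : Type*} [NormedAddCommGroup E] [InnerProductSpace ℝ E]
    (S : Set E) (x₀ : E) : Set E :=
  {v | limsup (fun x : E => ((inner ℝ v (x - x₀) / ‖x - x₀‖ : ℝ) : EReal)) (𝓝[S \ {x₀}] x₀) ≤ 0}

/-- The limiting (Mordukhovich) normal cone to `S` at `x₀`. -/
def limitingNormalCone {E : Type*} [NormedAddCommGroup E] [InnerProductSpace ℝ E]
    (S : Set E) (x₀ : E) : Set E :=
  {v | ∃ (x w : ℕ → E), (∀ k, x k ∈ S) ∧ Tendsto x atTop (𝓝 x₀) ∧ Tendsto w atTop (𝓝 v) ∧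
    ∀ k, w k ∈ regularNormalCone S (x k)}

/-! ### Rank constraint systems

Throughout, `𝕏` is a space of real `n × m` matrices with `n ≤ m` (in the theorem: `FullSpace n m`,
or `SymSpace n` with `m = n`). -/

/-- `σ_{i+1}(X)`: the singular values in nonincreasing order, indexed from `0`. -/
def singularValue {n m : ℕ} (X : Matrix (Fin n) (Fin m) ℝ) (i : ℕ) : ℝ :=
  (Matrix.toEuclideanLin X).singularValues i

/-- The Ky Fan `r`-norm: the sum of the `r` largest singular values. -/
def kyFanNorm {n m : ℕ} (r : ℕ) (X : Matrix (Fin n) (Fin m) ℝ) : ℝ :=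
  ∑ i ∈ Finset.range r, singularValue X i

/-- The nuclear norm: the sum of all singular values (there are `n` of them since `n ≤ m`). -/
def nuclearNorm {n m : ℕ} (X : Matrix (Fin n) (Fin m) ℝ) : ℝ :=
  ∑ i ∈ Finset.range n, singularValue X i

section

variable {n m : ℕ} {𝕏 : Submodule ℝ (Matrix (Fin n) (Fin m) ℝ)}

/-- `Λ_r = {X ∈ 𝕏 | rank X ≤ r}`. -/
def rankSet (𝕏 : Submodule ℝ (Matrix (Fin n) (Fin m) ℝ)) (r : ℕ) : Set 𝕏 :=
  {X | (X : Matrix (Fin n) (Fin m) ℝ).rank ≤ r}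

/-- `Γ_r = {X ∈ Ω | rank X ≤ r}`. -/
def rankSystem (Ω : Set 𝕏) (r : ℕ) : Set 𝕏 :=
  {X | X ∈ Ω ∧ (X : Matrix (Fin n) (Fin m) ℝ).rank ≤ r}

/-- The partial perturbation `𝒮_r(τ) = {X ∈ Ω | ‖X‖_* - ‖X‖_(r) = τ}`. -/
def perturbation (Ω : Set 𝕏) (r : ℕ) (τ : ℝ) : Set 𝕏 :=
  {X | X ∈ Ω ∧ nuclearNorm (X : Matrix (Fin n) (Fin m) ℝ) -
    kyFanNorm r (X : Matrix (Fin n) (Fin m) ℝ) = τ}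

/-- The perturbation `𝒮_r` associated with `Ω` is calm at `0` for every `X ∈ 𝒮_r(0)`. -/
def PerturbationCalm (Ω : Set 𝕏) (r : ℕ) : Prop :=
  ∀ X ∈ perturbation Ω r 0, IsCalmAt (perturbation Ω r) 0 X

/-- At every `X ∈ Γ_r`, `[-N_Ω(X)] ∩ N_{Λ_r}(X) = {0}` (normal cones taken in `𝕏`). -/
def FirstCriterion (Ω : Set 𝕏) (r : ℕ) : Prop :=
  ∀ X ∈ rankSystem Ω r,
    (-limitingNormalCone Ω X) ∩ limitingNormalCone (rankSet 𝕏 r) X = {0}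

end

/-- The cone `𝕊ⁿ₊` of positive semidefinite matrices. -/
def psdCone (n : ℕ) : Set (SymSpace n) :=
  {X | (X : Matrix (Fin n) (Fin n) ℝ).PosSemidef}

/-- `Λ_r⁺ = {X ∈ 𝕊ⁿ₊ | rank X ≤ r}`. -/
def psdRankSet (n r : ℕ) : Set (SymSpace n) :=
  {X | X ∈ psdCone n ∧ (X : Matrix (Fin n) (Fin n) ℝ).rank ≤ r}

/-- For `Ω = 𝕊ⁿ₊ ∩ Ξ`: at every `X ∈ Γ_r`, `[-N_Ξ(X)] ∩ N_{Λ_r⁺}(X) = {0}`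
(normal cones taken in `𝕊ⁿ`). -/
def SecondCriterion {n : ℕ} (Ξ : Set (SymSpace n)) (r : ℕ) : Prop :=
  ∀ X ∈ rankSystem (psdCone n ∩ Ξ) r,
    (-limitingNormalCone Ξ X) ∩ limitingNormalCone (psdRankSet n r) X = {0}

/-! ### The constraint sets -/

/-- The closed ball of radius `ϱ` of a (semi)norm on `𝕏`. -/
def normBall {n m : ℕ} {𝕏 : Submodule ℝ (Matrix (Fin n) (Fin m) ℝ)} (p : Seminorm ℝ 𝕏) (ϱ : ℝ) :
    Set 𝕏 :=
  {Z | p Z ≤ ϱ}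

/-- The Frobenius sphere of radius `ϱ`. -/
def frobeniusSphere {n m : ℕ} (𝕏 : Submodule ℝ (Matrix (Fin n) (Fin m) ℝ)) (ϱ : ℝ) : Set 𝕏 :=
  {Z | ‖Z‖ = ϱ}

/-- `{X ∈ 𝕊ⁿ | diag X = e}`. -/
def unitDiagonalSet (n : ℕ) : Set (SymSpace n) :=
  {X | ∀ i, X.1 i i = 1}

/-- `{X ∈ 𝕊ⁿ | ⟨C, X⟩ = c}`. -/
def traceHyperplane {n : ℕ} (C : SymSpace n) (c : ℝ) : Set (SymSpace n) :=
  {X | inner ℝ C X = c}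

/-- `{X ∈ 𝕊ⁿ | X₁₁ = 1, X_ii - (X_1i + X_i1) / 2 = 0 for i = 2, …, n}`; the index `1` here
is the element `0` of `Fin n`. -/
def zeroOneSet (n : ℕ) (hn : 0 < n) : Set (SymSpace n) :=
  {X | X.1 ⟨0, hn⟩ ⟨0, hn⟩ = 1 ∧
    ∀ i : Fin n, i ≠ ⟨0, hn⟩ → X.1 i i - 1 / 2 * (X.1 ⟨0, hn⟩ i + X.1 i ⟨0, hn⟩) = 0}

/-- The `(i, j)` block of size `p × p` of a matrix of order `n = k p`. Here
`finProdFinEquiv (i, a)` is the index `p i + a`. -/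
def block {n k p : ℕ} (h : k * p = n) (X : Matrix (Fin n) (Fin n) ℝ) (i j : Fin k) :
    Matrix (Fin p) (Fin p) ℝ :=
  Matrix.of fun a b => X (Fin.cast h (finProdFinEquiv (i, a))) (Fin.cast h (finProdFinEquiv (j, b)))

/-- `{X ∈ 𝕊ⁿ | ⟨I, X_ii⟩ = 1, ⟨I, X_ij⟩ = 0 for i ≠ j}` with `X_ij` the blocks. -/
def blockOrthogonalSet {n k p : ℕ} (h : k * p = n) : Set (SymSpace n) :=
  {X | (∀ i, (block h X.1 i i).trace = 1) ∧ ∀ i j, i ≠ j → (block h X.1 i j).trace = 0}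

/-- `{X ∈ ℝ^{n×n} | X ≥ 0 entrywise, X e = e}`. -/
def rowStochasticSet (n : ℕ) : Set (FullSpace n n) :=
  {X | (∀ i j, 0 ≤ X.1 i j) ∧ X.1 *ᵥ (fun _ => 1) = fun _ => 1}

/-- `{X ∈ ℝ^{n×n} | X ≥ 0 entrywise, X e = e, Xᵀ e = e}`. -/
def doublyStochasticSet (n : ℕ) : Set (FullSpace n n) :=
  {X | (∀ i j, 0 ≤ X.1 i j) ∧ X.1 *ᵥ (fun _ => 1) = (fun _ => 1) ∧
    X.1ᵀ *ᵥ (fun _ => 1) = fun _ => 1}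

end

end RankCalm

open RankCalm

/-!
For each constraint set the criterion is elementary once two facts about normal cones are known,
and calmness then follows from the criterion by one general error bound.

*Normals to the rank sets.*  A regular normal is orthogonal to the velocity of every curve
`x + t a + t² b` that stays in the set (`inner_eq_zero_of_mem_regularNormalCone`).  Rank does not
grow under multiplication by `1 + tH`, and `Λ_r⁺` is invariant under the congruences by `1 + tH`;
hence limiting normals `V` at `X` satisfy `⟨V, X⟩ = 0`, `V Xᵀ = 0` and `Xᵀ V = 0` for `Λ_r` in the
square matrices, and `V X = 0` for `Λ_r⁺` (`mul_eq_zero_of_mem_normalCone_psdRankSet`).  The other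
set is convex except for the sphere, so that `-V` normal to it means `⟨V, Z - X⟩ ≥ 0` throughout
it, and in each case these relations leave only `V = 0`.  For balls, `⟨V, ·⟩` is nonnegative on a
neighbourhood of the origin; on the sphere, normals are multiples of `X`; for the affine sets, the
constraints determine the shape of `V`, and well-chosen entries, traces or block traces of `V X`
recover its coefficients; for stochastic matrices, `Xᵀ V = 0` gives zero column sums, so that
`⟨V, ·⟩` vanishes at the barycentre `e eᵀ / n`, from which one can move in every direction.

*Calmness.*  If the criterion holds, the distance to `A ∩ B` is bounded on `A` by a multiple of the
distance to `B` (`exists_error_bound`).  Otherwise there are points of `A` whose distance to `A ∩ B`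
is arbitrarily large compared with their distance to `B`; minimising `‖a - b‖` plus a small smooth
penalty over `A × B` gives a pair `a ≠ b` at which the unit vector `u` along `a - b` is almost
normal to `B`, and `-u` to `A`, and a limit of these `u` violates the criterion.  The distance to
`Λ_r` or `Λ_r⁺` is at most `2 (‖X‖_* - ‖X‖_(r))`, as seen from `X P`, respectively `P X P`, where
`P` projects onto the `r` leading right singular vectors (`exists_projection_norm_sub_le`,
`norm_sub_conj_le`); the second choice preserves symmetry and positive semidefiniteness.
-/

namespace RankCalm

/-! ### Normal cones and error bounds -/

section Variational

variable {E : Type*} [NormedAddCommGroup E] [InnerProductSpace ℝ E]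

theorem mem_regularNormalCone_iff {S : Set E} {x v : E} :
    v ∈ regularNormalCone S x ↔
      ∀ ε > 0, ∀ᶠ y in 𝓝[S] x, inner ℝ v (y - x) ≤ ε * ‖y - x‖ := by
  have key : ∀ ε : ℝ, (∀ᶠ y in 𝓝[S] x, inner ℝ v (y - x) ≤ ε * ‖y - x‖) ↔
      ∀ᶠ y in 𝓝[S \ {x}] x, inner ℝ v (y - x) / ‖y - x‖ ≤ ε := by
    intro ε
    rw [eventually_nhdsWithin_iff, eventually_nhdsWithin_iff]
    refine eventually_congr (Eventually.of_forall fun y => ?_)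
    by_cases hy : y = x
    · simp [hy]
    · have : 0 < ‖y - x‖ := norm_pos_iff.2 (sub_ne_zero.2 hy)
      simp [hy, div_le_iff₀ this]
  simp only [key]
  rw [regularNormalCone, Set.mem_ofPred_eq, limsup_le_iff]
  constructor
  · intro h ε hε
    refine (h (ε : EReal) (by exact_mod_cast hε)).mono fun y hy => ?_
    exact (EReal.coe_lt_coe_iff.1 hy).le
  · intro h c hc
    obtain ⟨ε, h0, h1⟩ := EReal.lt_iff_exists_real_btwn.1 hc
    refine (h ε (by exact_mod_cast h0)).mono fun y hy => ?_
    exact lt_of_le_of_lt (EReal.coe_le_coe_iff.2 hy) h1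

/-- Regular normals make a nonacute angle with every one-sided tangent direction. -/
theorem inner_nonpos_of_mem_regularNormalCone {S : Set E} {x v w : E}
    (hv : v ∈ regularNormalCone S x) {c : ℝ → E} (hc0 : c 0 = x)
    (hc : HasDerivAt c w 0) (hcS : ∀ᶠ t in 𝓝[>] (0 : ℝ), c t ∈ S) : inner ℝ v w ≤ 0 := by
  have hslope : Tendsto (fun t : ℝ => t⁻¹ • (c t - x)) (𝓝[>] 0) (𝓝 w) := by
    have := hc.tendsto_slope_zero_right
    simpa [hc0] using this
  have hcont : Tendsto c (𝓝[>] 0) (𝓝[S] x) := by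
    refine tendsto_nhdsWithin_iff.2 ⟨?_, hcS⟩
    have := hc.continuousAt.tendsto
    rw [hc0] at this
    exact this.mono_left nhdsWithin_le_nhds
  have hbound : ∀ ε > 0, inner ℝ v w ≤ ε * ‖w‖ := by
    intro ε hε
    have hev := hcont.eventually (mem_regularNormalCone_iff.1 hv ε hε)
    refine le_of_tendsto_of_tendsto (tendsto_const_nhds.inner hslope)
      (hslope.norm.const_mul ε) ?_
    filter_upwards [hev, self_mem_nhdsWithin] with t ht ht0
    have ht0' : (0 : ℝ) < t⁻¹ := inv_pos.2 ht0
    rw [inner_smul_right, norm_smul, Real.norm_of_nonneg ht0'.le]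
    nlinarith [mul_le_mul_of_nonneg_left ht ht0'.le]
  refine le_of_forall_pos_le_add fun δ hδ => ?_
  have h1 : 0 < ‖w‖ + 1 := by positivity
  calc inner ℝ v w ≤ δ / (‖w‖ + 1) * ‖w‖ := hbound _ (by positivity)
    _ ≤ δ / (‖w‖ + 1) * (‖w‖ + 1) := by gcongr; linarith
    _ = 0 + δ := by field_simp; ring

/-- Regular normals are orthogonal to the velocity of every quadratic curve inside the set. -/
theorem inner_eq_zero_of_mem_regularNormalCone {S : Set E} {x v a b : E}
    (hv : v ∈ regularNormalCone S x) (hS : ∀ t : ℝ, x + t • a + t ^ 2 • b ∈ S) :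
    inner ℝ v a = 0 := by
  have hd : ∀ s : ℝ, HasDerivAt (fun t : ℝ => x + (s * t) • a + t ^ 2 • b) (s • a) 0 := by
    intro s
    have h1 : HasDerivAt (fun t : ℝ => (s * t) • a) (s • a) 0 := by
      simpa using ((hasDerivAt_id (0 : ℝ)).const_mul s).smul_const a
    have h2 : HasDerivAt (fun t : ℝ => t ^ 2 • b) ((0 : ℝ) • b) 0 := by
      simpa using ((hasDerivAt_id (0 : ℝ)).pow 2).smul_const b
    have h3 := (h1.const_add x).add h2
    rw [zero_smul, add_zero] at h3
    exact h3
  have h : ∀ s : ℝ, s ^ 2 = 1 → inner ℝ v (s • a) ≤ 0 := fun s hs =>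
    inner_nonpos_of_mem_regularNormalCone hv (by simp) (hd s) <| Eventually.of_forall fun t => by
      have := hS (s * t)
      rwa [mul_pow, hs, one_mul] at this
  have h1 := h 1 (by norm_num)
  have h2 := h (-1) (by norm_num)
  simp only [one_smul, neg_smul, inner_neg_right] at h1 h2
  linarith

theorem zero_mem_limitingNormalCone {S : Set E} {x : E} (hx : x ∈ S) :
    (0 : E) ∈ limitingNormalCone S x := by
  refine ⟨fun _ => x, fun _ => 0, fun _ => hx, tendsto_const_nhds, tendsto_const_nhds, fun _ => ?_⟩
  refine mem_regularNormalCone_iff.2 fun ε hε => Eventually.of_forall fun y => ?_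
  simpa using by positivity

theorem inner_sub_nonpos_of_mem_limitingNormalCone {S : Set E} (hS : Convex ℝ S) {x v z : E}
    (hv : v ∈ limitingNormalCone S x) (hz : z ∈ S) : inner ℝ v (z - x) ≤ 0 := by
  obtain ⟨y, w, hy, hyx, hwv, hw⟩ := hv
  refine le_of_tendsto (hwv.inner (tendsto_const_nhds.sub hyx)) (Eventually.of_forall fun k => ?_)
  refine inner_nonpos_of_mem_regularNormalCone (hw k)
    (c := fun t : ℝ => y k + t • (z - y k)) (by simp) ?_ ?_
  · simpa using ((hasDerivAt_id (0 : ℝ)).smul_const (z - y k)).const_add (y k)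
  · filter_upwards [Ioc_mem_nhdsGT (zero_lt_one' ℝ)] with t ht
    exact hS.add_smul_sub_mem (hy k) hz ⟨ht.1.le, ht.2⟩

/-- At a point of a cone, limiting normals are orthogonal to the point itself. -/
theorem inner_self_eq_zero_of_mem_limitingNormalCone {S : Set E}
    (hS : ∀ z ∈ S, ∀ t : ℝ, 0 ≤ t → t • z ∈ S) {x v : E}
    (hv : v ∈ limitingNormalCone S x) : inner ℝ v x = 0 := by
  obtain ⟨y, w, hy, hyx, hwv, hw⟩ := hv
  refine tendsto_nhds_unique (hwv.inner hyx) ?_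
  refine tendsto_const_nhds.congr fun k => (Eq.symm ?_ : (0 : ℝ) = _)
  -- `(1 + t)²` keeps the curve in the cone for every real `t`.
  have h := inner_eq_zero_of_mem_regularNormalCone (hw k) (a := (2 : ℝ) • y k) (b := y k)
    fun t => by
      have := hS _ (hy k) ((1 + t) ^ 2) (sq_nonneg _)
      convert this using 1
      module
  rw [inner_smul_right] at h
  linarith

/-- First-order optimality: if `a` minimises `‖· - b‖ + c ‖· - x‖²` over `S` and `a ≠ b`, the
negative gradient of this function at `a` is a regular normal. -/
theorem neg_gradient_mem_regularNormalCone {S : Set E} {a b x : E} {c : ℝ} (hab : a ≠ b)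
    (hc : 0 ≤ c)
    (hmin : ∀ y ∈ S, ‖a - b‖ + c * ‖a - x‖ ^ 2 ≤ ‖y - b‖ + c * ‖y - x‖ ^ 2) :
    -(‖a - b‖⁻¹ • (a - b) + (2 * c) • (a - x)) ∈ regularNormalCone S a := by
  rw [mem_regularNormalCone_iff]
  intro ε hε
  have hpos : 0 < ‖a - b‖ := norm_pos_iff.2 (sub_ne_zero.2 hab)
  -- the remainder of the first-order expansion is at most `(1 / (2‖a - b‖) + c) ‖y - a‖²`
  set K : ℝ := ‖a - b‖⁻¹ / 2 + c with hK
  have hKpos : 0 < K := by positivity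
  have hnear : ∀ᶠ y in 𝓝[S] a, ‖y - a‖ < ε / K := by
    refine eventually_nhdsWithin_of_eventually_nhds ?_
    have := Metric.ball_mem_nhds a (div_pos hε hKpos)
    filter_upwards [this] with y hy
    rwa [Metric.mem_ball, dist_eq_norm] at hy
  filter_upwards [hnear, self_mem_nhdsWithin] with y hy hyS
  have hm := hmin y hyS
  set h := y - a with hh
  have e1 : y - b = (a - b) + h := by rw [hh]; abel
  have e2 : y - x = (a - x) + h := by rw [hh]; abel
  have n2 : ‖y - x‖ ^ 2 = ‖a - x‖ ^ 2 + 2 * inner ℝ (a - x) h + ‖h‖ ^ 2 := by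
    rw [e2, norm_add_sq_real]
  have n1 : ‖y - b‖ ^ 2 = ‖a - b‖ ^ 2 + 2 * inner ℝ (a - b) h + ‖h‖ ^ 2 := by
    rw [e1, norm_add_sq_real]
  have n3 : ‖y - b‖ ≤ ‖a - b‖ + ‖a - b‖⁻¹ * inner ℝ (a - b) h + ‖a - b‖⁻¹ / 2 * ‖h‖ ^ 2 := by
    have h4 : 2 * ‖a - b‖ * ‖y - b‖ ≤ ‖a - b‖ ^ 2 + ‖y - b‖ ^ 2 := by
      nlinarith [sq_nonneg (‖a - b‖ - ‖y - b‖)]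
    have h5 : ‖y - b‖ = (2 * ‖a - b‖ * ‖y - b‖) * (‖a - b‖⁻¹ / 2) := by field_simp
    have h6 : (‖a - b‖ ^ 2 + ‖y - b‖ ^ 2) * (‖a - b‖⁻¹ / 2) =
        ‖a - b‖ + ‖a - b‖⁻¹ * inner ℝ (a - b) h + ‖a - b‖⁻¹ / 2 * ‖h‖ ^ 2 := by
      rw [n1]; field_simp; ring
    rw [← h6]
    exact h5.trans_le (mul_le_mul_of_nonneg_right h4 (by positivity))
  have h7 : -(‖a - b‖⁻¹ * inner ℝ (a - b) h + 2 * c * inner ℝ (a - x) h) ≤ K * ‖h‖ ^ 2 := by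
    rw [n2] at hm
    rw [hK]
    nlinarith
  have h8 : K * ‖h‖ ^ 2 ≤ ε * ‖h‖ := by
    have : K * ‖h‖ ≤ ε := by
      have := mul_le_mul_of_nonneg_left hy.le hKpos.le
      rwa [mul_div_cancel₀ _ hKpos.ne'] at this
    nlinarith [norm_nonneg h]
  calc inner ℝ (-(‖a - b‖⁻¹ • (a - b) + (2 * c) • (a - x))) h
      = -(‖a - b‖⁻¹ * inner ℝ (a - b) h + 2 * c * inner ℝ (a - x) h) := by
        rw [inner_neg_left, inner_add_left, real_inner_smul_left, real_inner_smul_left]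
    _ ≤ _ := h7.trans h8

/-- The penalised distance between two closed sets is attained. -/
theorem exists_penalized_minimizer [FiniteDimensional ℝ E] {A B : Set E} (hA : IsClosed A)
    (hB : IsClosed B) {a₀ b₀ : E} (ha₀ : a₀ ∈ A) (hb₀ : b₀ ∈ B) (x : E) {c : ℝ} (hc : 0 < c) :
    ∃ a ∈ A, ∃ b ∈ B, ∀ a' ∈ A, ∀ b' ∈ B,
      ‖a - b‖ + c * (‖a - x‖ ^ 2 + ‖b - x‖ ^ 2) ≤
        ‖a' - b'‖ + c * (‖a' - x‖ ^ 2 + ‖b' - x‖ ^ 2) := by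
  have : ProperSpace E := FiniteDimensional.proper_real E
  let f : E × E → ℝ := fun p => ‖p.1 - p.2‖ + c * (‖p.1 - x‖ ^ 2 + ‖p.2 - x‖ ^ 2)
  have hf : Continuous f := by fun_prop
  set R : ℝ := f (a₀, b₀) / c + 1 with hR
  have hf0 : 0 ≤ f (a₀, b₀) := by positivity
  -- outside a ball of radius `R` around `x` the penalty exceeds its value at `(a₀, b₀)`
  have hout : ∀ p : E × E, R < dist p (x, x) → f (a₀, b₀) ≤ f p := by
    intro p hp
    have hR1 : 1 ≤ R := by rw [hR]; linarith [div_nonneg hf0 hc.le]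
    have h1 : R ^ 2 ≤ ‖p.1 - x‖ ^ 2 + ‖p.2 - x‖ ^ 2 := by
      rw [Prod.dist_eq, lt_max_iff, dist_eq_norm, dist_eq_norm] at hp
      rcases hp with hp | hp <;> nlinarith [sq_nonneg ‖p.1 - x‖, sq_nonneg ‖p.2 - x‖]
    have h2 : f (a₀, b₀) ≤ c * R ^ 2 := by
      have : f (a₀, b₀) ≤ c * R := by
        rw [hR, mul_add, mul_div_cancel₀ _ hc.ne']; linarith
      nlinarith
    have h3 := mul_le_mul_of_nonneg_left h1 hc.le
    have h4 : c * (‖p.1 - x‖ ^ 2 + ‖p.2 - x‖ ^ 2) ≤ f p := by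
      simp only [f]; linarith [norm_nonneg (p.1 - p.2)]
    linarith
  have hev : ∀ᶠ p in cocompact (E × E) ⊓ 𝓟 (A ×ˢ B), f (a₀, b₀) ≤ f p := by
    refine Eventually.filter_mono inf_le_left ?_
    filter_upwards [(isCompact_closedBall ((x, x) : E × E) R).compl_mem_cocompact] with p hp
    exact hout p (by simpa [Metric.mem_closedBall] using hp)
  obtain ⟨p, hp, hpm⟩ := hf.continuousOn.exists_isMinOn' (hA.prod hB)
    (x₀ := (a₀, b₀)) ⟨ha₀, hb₀⟩ hev
  exact ⟨p.1, hp.1, p.2, hp.2, fun a' ha' b' hb' => hpm (show (a', b') ∈ A ×ˢ B from ⟨ha', hb'⟩)⟩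

/-- Under the normal cone qualification `(-N_A(x₀)) ∩ N_B(x₀) = {0}`, the distance to `A ∩ B` is
bounded near `x₀` on `A` by a multiple of the distance to `B`. -/
theorem exists_error_bound [FiniteDimensional ℝ E] {A B : Set E} (hA : IsClosed A)
    (hB : IsClosed B) {x₀ : E} (hx₀ : x₀ ∈ A ∩ B)
    (hN : (-limitingNormalCone A x₀) ∩ limitingNormalCone B x₀ = {0}) :
    ∃ κ : ℝ, 0 ≤ κ ∧ ∃ δ > 0, ∀ x ∈ A, ‖x - x₀‖ ≤ δ → ∀ z ∈ B,
      ∃ y ∈ A ∩ B, ‖x - y‖ ≤ κ * ‖x - z‖ := by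
  by_contra hcon
  push Not at hcon
  have : ProperSpace E := FiniteDimensional.proper_real E
  have hseq : ∀ j : ℕ, ∃ a ∈ A, ∃ b ∈ B, ∃ u g h : E, ‖u‖ = 1 ∧
      ‖a - x₀‖ ≤ 2 / ((j : ℝ) + 1) ∧ ‖b - x₀‖ ≤ 2 / ((j : ℝ) + 1) ∧
      ‖g‖ ≤ 4 / ((j : ℝ) + 1) ∧ ‖h‖ ≤ 4 / ((j : ℝ) + 1) ∧
      -(u + g) ∈ regularNormalCone A a ∧ u - h ∈ regularNormalCone B b := by
    intro j
    set l : ℝ := (j : ℝ) + 2 with hl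
    have hl2 : 2 ≤ l := by rw [hl]; linarith [(Nat.cast_nonneg j : (0 : ℝ) ≤ j)]
    set k : ℝ := l ^ 2 with hk
    have hk2 : 2 ≤ k := by rw [hk]; nlinarith
    have hj : (0 : ℝ) < (j : ℝ) + 1 := by positivity
    obtain ⟨x, hxA, hxδ, z, hzB, hz⟩ := hcon k (by linarith) (1 / ((j : ℝ) + 1)) (by positivity)
    set e : ℝ := ‖x - z‖ with he
    have he0 : 0 < e := by
      refine norm_pos_iff.2 (sub_ne_zero.2 ?_)
      rintro rfl
      have := hz x ⟨hxA, hzB⟩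
      rw [he, sub_self, norm_zero, mul_zero] at this
      exact lt_irrefl _ this
    -- this weight makes the penalty gradients of order `k^(-1/2)`, while the minimiser stays
    -- within `k e` of `x`
    set c : ℝ := 1 / (k * e) with hc
    have hc0 : 0 < c := by positivity
    obtain ⟨a, ha, b, hb, hmin⟩ := exists_penalized_minimizer hA hB hxA hzB x hc0
    have hval := hmin x hxA z hzB
    rw [sub_self, norm_zero, norm_sub_rev z x, ← he] at hval
    have hsum : ‖a - x‖ ^ 2 + ‖b - x‖ ^ 2 ≤ (k + 1) * e ^ 2 := by
      have h1 : c * (‖a - x‖ ^ 2 + ‖b - x‖ ^ 2) ≤ c * ((k + 1) * e ^ 2) := by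
        have h2 : e + c * (0 ^ 2 + e ^ 2) = c * ((k + 1) * e ^ 2) := by
          rw [hc]; field_simp; ring
        linarith [norm_nonneg (a - b)]
      exact le_of_mul_le_mul_left h1 hc0
    have hx₀k : k * e < ‖x - x₀‖ := hz x₀ hx₀
    have hdist : ∀ w : E, ‖w - x‖ ^ 2 ≤ (k + 1) * e ^ 2 →
        ‖w - x‖ ≤ k * e ∧ ‖w - x₀‖ ≤ 2 / ((j : ℝ) + 1) ∧
          ‖(2 * c) • (w - x)‖ ≤ 4 / ((j : ℝ) + 1) := by
      intro w hw
      have h1 : ‖w - x‖ ≤ k * e := by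
        refine abs_le_of_sq_le_sq' (hw.trans ?_) (by positivity) |>.2
        rw [mul_pow]
        gcongr
        nlinarith
      refine ⟨h1, ?_, ?_⟩
      · calc ‖w - x₀‖ ≤ ‖w - x‖ + ‖x - x₀‖ := norm_sub_le_norm_sub_add_norm_sub _ _ _
          _ ≤ 1 / ((j : ℝ) + 1) + 1 / ((j : ℝ) + 1) := by linarith
          _ = 2 / ((j : ℝ) + 1) := by ring
      · have h2 : ‖w - x‖ ≤ 2 * (l * e) := by
          refine abs_le_of_sq_le_sq' (hw.trans ?_) (by positivity) |>.2
          have : (2 * (l * e)) ^ 2 = 4 * k * e ^ 2 := by rw [hk]; ring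
          rw [this]
          gcongr
          linarith
        rw [norm_smul, Real.norm_of_nonneg (by positivity)]
        calc 2 * c * ‖w - x‖ ≤ 2 * c * (2 * (l * e)) := by gcongr
          _ = 4 / l := by rw [hc, hk]; field_simp; ring
          _ ≤ 4 / ((j : ℝ) + 1) := by gcongr; linarith
    obtain ⟨ha1, ha2, ha3⟩ := hdist a (by linarith [sq_nonneg ‖b - x‖])
    obtain ⟨hb1, hb2, hb3⟩ := hdist b (by linarith [sq_nonneg ‖a - x‖])
    have hab : a ≠ b := by
      rintro rfl
      have := hz a ⟨ha, hb⟩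
      rw [norm_sub_rev] at this
      linarith
    have hpos : 0 < ‖a - b‖ := norm_pos_iff.2 (sub_ne_zero.2 hab)
    refine ⟨a, ha, b, hb, ‖a - b‖⁻¹ • (a - b), (2 * c) • (a - x), (2 * c) • (b - x), ?_, ha2, hb2,
      ha3, hb3, ?_, ?_⟩
    · rw [norm_smul, norm_inv, norm_norm, inv_mul_cancel₀ hpos.ne']
    · refine neg_gradient_mem_regularNormalCone hab hc0.le fun y hy => ?_
      have := hmin y hy b hb
      linarith
    · have h := neg_gradient_mem_regularNormalCone (S := B) (x := x) hab.symm hc0.le fun y hy => by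
        have := hmin a ha y hy
        rw [norm_sub_rev b a, norm_sub_rev y a]
        linarith
      convert h using 1
      rw [norm_sub_rev b a]
      module
  choose a ha b hb u g h hu hax hbx hg hh hNA hNB using hseq
  have hlim : ∀ C : ℝ, Tendsto (fun j : ℕ => C / ((j : ℝ) + 1)) atTop (𝓝 0) := fun C => by
    simpa [div_eq_mul_inv] using (tendsto_one_div_add_atTop_nhds_zero_nat (𝕜 := ℝ)).const_mul C
  obtain ⟨u₀, hu₀, φ, hφ, hφu⟩ := (isCompact_sphere (0 : E) 1).tendsto_subseq
    (x := u) fun j => by simp [hu j]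
  have hto : ∀ (C : ℝ) (s : ℕ → E) (y : E), (∀ j, ‖s j - y‖ ≤ C / ((j : ℝ) + 1)) →
      Tendsto (s ∘ φ) atTop (𝓝 y) := fun C s y hs => by
    have := squeeze_zero_norm hs (hlim C)
    exact (tendsto_sub_nhds_zero_iff.1 this).comp hφ.tendsto_atTop
  have hA' : -u₀ ∈ limitingNormalCone A x₀ :=
    ⟨a ∘ φ, fun j => -(u (φ j) + g (φ j)), fun j => ha _, hto 2 a x₀ hax,
      by simpa using (hφu.add (hto 4 g 0 (by simpa using hg))).neg, fun j => hNA _⟩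
  have hB' : u₀ ∈ limitingNormalCone B x₀ :=
    ⟨b ∘ φ, fun j => u (φ j) - h (φ j), fun j => hb _, hto 2 b x₀ hbx,
      by simpa using hφu.sub (hto 4 h 0 (by simpa using hh)), fun j => hNB _⟩
  have h0 : u₀ ∈ (-limitingNormalCone A x₀) ∩ limitingNormalCone B x₀ := ⟨hA', hB'⟩
  rw [hN, Set.mem_singleton_iff] at h0
  simp [h0] at hu₀

end Variational

/-! ### Singular values and truncation -/

section SingularValues

variable {n m : ℕ}

theorem norm_sq_eq_trace (A : Matrix (Fin n) (Fin m) ℝ) : ‖A‖ ^ 2 = (Aᵀ * A).trace :=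
  (real_inner_self_eq_norm_sq A).symm

theorem norm_transpose_eq (A : Matrix (Fin n) (Fin m) ℝ) : ‖Aᵀ‖ = ‖A‖ := 
  Matrix.frobenius_norm_transpose A

theorem rank_eq_finrank_range_toEuclideanLin (X : Matrix (Fin n) (Fin m) ℝ) :
    X.rank = Module.finrank ℝ (Matrix.toEuclideanLin X).range := by
  rw [Matrix.toEuclideanLin_eq_toLin_orthonormal]
  exact Matrix.rank_eq_finrank_range_toLin X _ _

theorem singularValue_eq_zero_of_rank_le {X : Matrix (Fin n) (Fin m) ℝ} {i : ℕ}
    (h : X.rank ≤ i) : singularValue X i = 0 := by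
  rw [rank_eq_finrank_range_toEuclideanLin] at h
  exact (LinearMap.singularValues_eq_zero_iff_le_finrank_range _).2 h

theorem singularValue_nonneg (X : Matrix (Fin n) (Fin m) ℝ) (i : ℕ) : 0 ≤ singularValue X i :=
  LinearMap.singularValues_nonneg _ i

theorem nuclearNorm_sub_kyFanNorm {r : ℕ} (hrn : r ≤ n) (X : Matrix (Fin n) (Fin m) ℝ) :
    nuclearNorm X - kyFanNorm r X = ∑ i ∈ Finset.Ico r n, singularValue X i := by
  rw [nuclearNorm, kyFanNorm, Finset.sum_Ico_eq_sub _ hrn]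

theorem nuclearNorm_sub_kyFanNorm_nonneg {r : ℕ} (hrn : r ≤ n) (X : Matrix (Fin n) (Fin m) ℝ) :
    0 ≤ nuclearNorm X - kyFanNorm r X := by
  rw [nuclearNorm_sub_kyFanNorm hrn]
  exact Finset.sum_nonneg fun i _ => singularValue_nonneg X i

theorem nuclearNorm_sub_kyFanNorm_eq_zero_iff {r : ℕ} (hrn : r ≤ n)
    (X : Matrix (Fin n) (Fin m) ℝ) : nuclearNorm X - kyFanNorm r X = 0 ↔ X.rank ≤ r := by
  rw [nuclearNorm_sub_kyFanNorm hrn,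
    Finset.sum_eq_zero_iff_of_nonneg fun i _ => singularValue_nonneg X i]
  constructor
  · intro h
    rcases hrn.eq_or_lt with rfl | hlt
    · exact X.rank_le_height
    · have := h r (Finset.left_mem_Ico.2 hlt)
      rw [rank_eq_finrank_range_toEuclideanLin]
      exact (LinearMap.singularValues_eq_zero_iff_le_finrank_range _).1 this
  · intro h i hi
    exact singularValue_eq_zero_of_rank_le (h.trans (Finset.mem_Ico.1 hi).1)

/-- An orthogonal matrix of right singular vectors diagonalises `Xᵀ X`. -/
theorem exists_orthogonal_gram_eq_diagonal (X : Matrix (Fin n) (Fin m) ℝ) :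
    ∃ U : Matrix (Fin m) (Fin m) ℝ, Uᵀ * U = 1 ∧ U * Uᵀ = 1 ∧
      (X * U)ᵀ * (X * U) = Matrix.diagonal fun i : Fin m => singularValue X i ^ 2 := by
  set T := Matrix.toEuclideanLin X with hT
  have hm : Module.finrank ℝ (EuclideanSpace ℝ (Fin m)) = m := by simp
  obtain ⟨b, hb⟩ : ∃ b : OrthonormalBasis (Fin m) ℝ (EuclideanSpace ℝ (Fin m)),
      ∀ j : Fin m, (LinearMap.adjoint T ∘ₗ T) (b j) = singularValue X j ^ 2 • b j :=
    ⟨T.isSymmetric_adjoint_comp_self.eigenvectorBasis hm, fun j => by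
      rw [T.isSymmetric_adjoint_comp_self.apply_eigenvectorBasis hm j, singularValue, ← hT,
        T.sq_singularValues_fin hm]
      rfl⟩
  let U : Matrix (Fin m) (Fin m) ℝ := Matrix.of fun a i => b i a
  have hU : Uᵀ * U = 1 := by
    ext i j
    have := orthonormal_iff_ite.1 b.orthonormal i j
    rw [PiLp.inner_apply] at this
    rw [Matrix.mul_apply, Matrix.one_apply, ← this]
    refine Finset.sum_congr rfl fun a _ => ?_
    rw [Matrix.transpose_apply, mul_comm]
    rfl
  refine ⟨U, hU, mul_eq_one_comm.1 hU, ?_⟩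
  ext i j
  have h1 : inner ℝ (T (b i)) (T (b j)) = ((X * U)ᵀ * (X * U)) i j := by
    have hTb : ∀ i a, T (b i) a = (X * U) a i := fun i a => rfl
    rw [PiLp.inner_apply, Matrix.mul_apply]
    refine Finset.sum_congr rfl fun a _ => ?_
    rw [hTb, hTb, Matrix.transpose_apply, mul_comm]
    rfl
  have h2 : inner ℝ (T (b i)) (T (b j)) =
      inner ℝ (b i) ((LinearMap.adjoint T ∘ₗ T) (b j)) := by
    rw [LinearMap.comp_apply, LinearMap.adjoint_inner_right]
  rw [← h1, h2, hb, inner_smul_right, orthonormal_iff_ite.1 b.orthonormal, Matrix.diagonal_apply]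
  by_cases hij : i = j
  · simp [hij]
  · simp [hij]

/-- The projection onto the leading `r` right singular vectors: the part of `X` it annihilates is
controlled by the trailing singular values. -/
theorem exists_projection_norm_sub_le {r : ℕ} (hrn : r ≤ n) (hnm : n ≤ m)
    (X : Matrix (Fin n) (Fin m) ℝ) :
    ∃ P : Matrix (Fin m) (Fin m) ℝ, Pᵀ = P ∧ P * P = P ∧ P.rank ≤ r ∧
      ‖X - X * P‖ ≤ nuclearNorm X - kyFanNorm r X := by
  obtain ⟨U, hU, hU', hX⟩ := exists_orthogonal_gram_eq_diagonal X
  let D : Matrix (Fin m) (Fin m) ℝ := Matrix.diagonal fun i => if (i : ℕ) < r then 1 else 0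
  have hDD : D * D = D := by
    simp only [D, Matrix.diagonal_mul_diagonal]
    congr 1; ext i; split_ifs <;> simp
  have hDt : Dᵀ = D := Matrix.diagonal_transpose _
  have hDr : D.rank ≤ r := by
    rw [Matrix.rank_diagonal]
    calc Fintype.card {i : Fin m // (if (i : ℕ) < r then (1 : ℝ) else 0) ≠ 0}
        ≤ Fintype.card (Fin r) := Fintype.card_le_of_injective
          (fun i => ⟨i.1, by by_contra h; exact i.2 (if_neg h)⟩) fun i j hij => by
            apply Subtype.ext; apply Fin.ext; simpa using hij
      _ = r := Fintype.card_fin r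
  refine ⟨U * D * Uᵀ, ?_, ?_, ?_, ?_⟩
  · simp [Matrix.transpose_mul, hDt, Matrix.mul_assoc]
  · calc U * D * Uᵀ * (U * D * Uᵀ) = U * D * (Uᵀ * U) * D * Uᵀ := by simp only [Matrix.mul_assoc]
      _ = U * (D * D) * Uᵀ := by rw [hU, Matrix.mul_one]; simp only [Matrix.mul_assoc]
      _ = U * D * Uᵀ := by rw [hDD]
  · exact ((Matrix.rank_mul_le_left _ _).trans (Matrix.rank_mul_le_right _ _)).trans hDr
  · have h1 : X - X * (U * D * Uᵀ) = (X * U) * (1 - D) * Uᵀ := by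
      rw [Matrix.mul_sub, Matrix.sub_mul, Matrix.mul_one, Matrix.mul_assoc X U Uᵀ, hU',
        Matrix.mul_one]
      simp only [Matrix.mul_assoc]
    have h2 : ‖X - X * (U * D * Uᵀ)‖ ^ 2 = ∑ i ∈ Finset.Ico r m, singularValue X i ^ 2 := by
      rw [h1, norm_sq_eq_trace, Matrix.transpose_mul, Matrix.transpose_transpose,
        Matrix.transpose_mul]
      have h3 : (U * ((1 - D)ᵀ * (X * U)ᵀ) * (X * U * (1 - D) * Uᵀ)).trace =
          ((1 - D) * (1 - D) * ((X * U)ᵀ * (X * U))).trace := by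
        calc _ = (U * ((1 - D)ᵀ * (X * U)ᵀ * (X * U * (1 - D))) * Uᵀ).trace := by
              simp only [Matrix.mul_assoc]
          _ = ((Uᵀ * U) * ((1 - D)ᵀ * (X * U)ᵀ * (X * U * (1 - D)))).trace := by
              rw [Matrix.trace_mul_comm, ← Matrix.mul_assoc]
          _ = ((1 - D) * ((X * U)ᵀ * (X * U) * (1 - D))).trace := by
              rw [hU, Matrix.one_mul, Matrix.transpose_sub, hDt, Matrix.transpose_one]
              simp only [Matrix.mul_assoc]
          _ = _ := by
              rw [Matrix.trace_mul_comm, Matrix.mul_assoc, Matrix.trace_mul_comm]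
      have h4 : (1 - D) * (1 - D) = 1 - D := by
        rw [Matrix.mul_sub, Matrix.mul_one, Matrix.sub_mul, Matrix.one_mul, hDD, sub_self, sub_zero]
      have h5 : (1 : Matrix (Fin m) (Fin m) ℝ) - D =
          Matrix.diagonal fun i : Fin m => if (i : ℕ) < r then 0 else 1 := by
        rw [← Matrix.diagonal_one, Matrix.diagonal_sub]
        congr 1; ext i; split_ifs <;> simp
      rw [h3, h4, hX, h5, Matrix.diagonal_mul_diagonal, Matrix.trace_diagonal,
        ← Finset.sum_range fun i : ℕ => (if i < r then (0 : ℝ) else 1) * singularValue X i ^ 2,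
        Finset.range_eq_Ico, ← Finset.sum_Ico_consecutive _ (Nat.zero_le r) (hrn.trans hnm),
        Finset.sum_eq_zero, zero_add]
      · refine Finset.sum_congr rfl fun i hi => ?_
        rw [if_neg (Finset.mem_Ico.1 hi).1.not_gt, one_mul]
      · intro i hi
        rw [if_pos (Finset.mem_Ico.1 hi).2, zero_mul]
    have h6 : ∑ i ∈ Finset.Ico r m, singularValue X i ^ 2 =
        ∑ i ∈ Finset.Ico r n, singularValue X i ^ 2 := by
      refine (Finset.sum_subset (Finset.Ico_subset_Ico_right hnm) fun i hi hi' => ?_).symm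
      rw [singularValue_eq_zero_of_rank_le (X.rank_le_height.trans ?_)]
      · norm_num
      · simp only [Finset.mem_Ico] at hi hi'; omega
    rw [nuclearNorm_sub_kyFanNorm hrn]
    refine abs_le_of_sq_le_sq' ?_ (Finset.sum_nonneg fun i _ => singularValue_nonneg X i) |>.2
    rw [h2, h6]
    exact Finset.sum_sq_le_sq_sum_of_nonneg fun i _ => singularValue_nonneg X i

/-- Projecting on both sides at most doubles the error of projecting on the right. -/
theorem norm_sub_conj_le {X P : Matrix (Fin n) (Fin n) ℝ} (hX : Xᵀ = X) (hP : Pᵀ = P)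
    (hPP : P * P = P) : ‖X - P * X * P‖ ≤ 2 * ‖X - X * P‖ := by
  have h1 : ‖X - P * X‖ = ‖X - X * P‖ := by
    rw [← norm_transpose_eq, Matrix.transpose_sub, Matrix.transpose_mul, hX, hP]
  have h2 : ∀ A : Matrix (Fin n) (Fin n) ℝ, ‖A * P‖ ≤ ‖A‖ := by
    intro A
    -- Pythagoras for the decomposition `A = A P + (A - A P)`
    have h3 : inner ℝ (A * P) (A - A * P) = (0 : ℝ) := by
      change ((A * P)ᵀ * (A - A * P)).trace = 0
      rw [Matrix.transpose_mul, hP, Matrix.mul_assoc, Matrix.trace_mul_comm, Matrix.mul_assoc,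
        Matrix.sub_mul, Matrix.mul_assoc A P P, hPP, sub_self, Matrix.mul_zero, Matrix.trace_zero]
    have h4 := norm_add_sq_real (A * P) (A - A * P)
    rw [add_sub_cancel, h3] at h4
    refine abs_le_of_sq_le_sq' ?_ (norm_nonneg A) |>.2
    nlinarith [sq_nonneg ‖A - A * P‖]
  calc ‖X - P * X * P‖ = ‖(X - X * P) + (X - P * X) * P‖ := by
        congr 1; rw [Matrix.sub_mul]; abel
    _ ≤ ‖X - X * P‖ + ‖(X - P * X) * P‖ := norm_add_le _ _
    _ ≤ ‖X - X * P‖ + ‖X - X * P‖ := by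
        gcongr; exact (h2 _).trans h1.le
    _ = 2 * ‖X - X * P‖ := by ring

theorem isClosed_setOf_rank_le (r : ℕ) :
    IsClosed {X : Matrix (Fin n) (Fin m) ℝ | X.rank ≤ r} := by
  let L : Matrix (Fin n) (Fin m) ℝ →ₗ[ℝ]
      (EuclideanSpace ℝ (Fin m) →L[ℝ] EuclideanSpace ℝ (Fin n)) :=
    LinearMap.toContinuousLinearMap.toLinearMap ∘ₗ Matrix.toEuclideanLin.toLinearMap
  have hL : Continuous L := L.continuous_of_finiteDimensional
  have hset : {X : Matrix (Fin n) (Fin m) ℝ | X.rank ≤ r}ᶜ =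
      L ⁻¹' {f | ((r + 1 : ℕ) : Cardinal) ≤
        (f : EuclideanSpace ℝ (Fin m) →ₗ[ℝ] EuclideanSpace ℝ (Fin n)).rank} := by
    ext X
    have h : ((L X : EuclideanSpace ℝ (Fin m) →L[ℝ] EuclideanSpace ℝ (Fin n)) :
        EuclideanSpace ℝ (Fin m) →ₗ[ℝ] EuclideanSpace ℝ (Fin n)) = Matrix.toEuclideanLin X := rfl
    rw [Set.mem_compl_iff, Set.mem_ofPred_eq, Set.mem_preimage, Set.mem_ofPred_eq, h,
      LinearMap.rank, ← Module.finrank_eq_rank, Nat.cast_le, rank_eq_finrank_range_toEuclideanLin,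
      not_le, Nat.succ_le_iff]
  rw [← isOpen_compl_iff, hset]
  exact (isOpen_setOfPred_nat_le_rank (r + 1)).preimage hL

end SingularValues

/-! ### Normals to rank sets and calmness from the criteria -/

section Calmness

variable {n m : ℕ} {𝕏 : Submodule ℝ (Matrix (Fin n) (Fin m) ℝ)}

/-- Calmness of the rank perturbation when `Γ_r` is the intersection of two closed sets `A ⊇ Ω` and
`B` satisfying the normal cone qualification, and `‖X‖_* - ‖X‖_(r)` controls the distance to `B`. -/
theorem perturbationCalm_of_qualification {r : ℕ} (hrn : r ≤ n) {Ω A B : Set 𝕏} (hA : IsClosed A)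
    (hB : IsClosed B) (hΩ : Ω ⊆ A) (hΓ : A ∩ B = rankSystem Ω r)
    (hN : ∀ X ∈ rankSystem Ω r,
      (-limitingNormalCone A X) ∩ limitingNormalCone B X = {0})
    (htrunc : ∀ X ∈ Ω, ∃ Z ∈ B, ‖X - Z‖ ≤ 2 * (nuclearNorm X.1 - kyFanNorm r X.1)) :
    PerturbationCalm Ω r := by
  intro X₀ hX₀
  have hX₀' : X₀ ∈ rankSystem Ω r :=
    ⟨hX₀.1, (nuclearNorm_sub_kyFanNorm_eq_zero_iff hrn _).1 hX₀.2⟩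
  obtain ⟨κ, hκ, δ, hδ, hbound⟩ := exists_error_bound hA hB (hΓ ▸ hX₀') (hN X₀ hX₀')
  refine ⟨hX₀, κ * 2, by positivity, 1, one_pos, δ, hδ, fun τ _ X hX => ?_⟩
  obtain ⟨⟨hXΩ, hXτ⟩, hXδ⟩ := hX
  obtain ⟨Z, hZB, hXZ⟩ := htrunc X hXΩ
  rw [Metric.mem_closedBall, dist_eq_norm] at hXδ
  obtain ⟨Y, hY, hXY⟩ := hbound X (hΩ hXΩ) hXδ Z hZB
  rw [hΓ] at hY
  refine ⟨Y, ⟨hY.1, (nuclearNorm_sub_kyFanNorm_eq_zero_iff hrn _).2 hY.2⟩, X - Y, ?_,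
    add_sub_cancel Y X⟩
  have hτ : 0 ≤ τ := hXτ ▸ nuclearNorm_sub_kyFanNorm_nonneg hrn _
  rw [smul_unitClosedBall_of_nonneg (by positivity), mem_closedBall_zero_iff, sub_zero,
    Real.norm_of_nonneg hτ]
  rw [hXτ] at hXZ
  calc ‖X - Y‖ ≤ κ * ‖X - Z‖ := hXY
    _ ≤ κ * (2 * τ) := by gcongr
    _ = κ * 2 * τ := by ring

theorem isClosed_rankSet (𝕏 : Submodule ℝ (Matrix (Fin n) (Fin m) ℝ)) (r : ℕ) :
    IsClosed (rankSet 𝕏 r) :=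
  (isClosed_setOf_rank_le r).preimage continuous_subtype_val

theorem isClosed_psdCone (n : ℕ) : IsClosed (psdCone n) := by
  have h : psdCone n = ⋂ x : Fin n → ℝ, {X : SymSpace n | 0 ≤ x ⬝ᵥ (X.1 *ᵥ x)} := by
    ext X
    rw [Set.mem_iInter]
    refine ⟨fun hX x => by simpa using hX.dotProduct_mulVec_nonneg x, fun hX => ?_⟩
    refine Matrix.PosSemidef.of_dotProduct_mulVec_nonneg ?_ fun x => by simpa using hX x
    exact (Matrix.conjTranspose_eq_transpose_of_trivial X.1).trans X.2
  rw [h]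
  refine isClosed_iInter fun x => isClosed_le continuous_const ?_
  exact continuous_const.dotProduct (continuous_subtype_val.matrix_mulVec continuous_const)

theorem isClosed_psdRankSet (n r : ℕ) : IsClosed (psdRankSet n r) :=
  (isClosed_psdCone n).inter (isClosed_rankSet (SymSpace n) r)

theorem rank_smul_le (t : ℝ) (A : Matrix (Fin n) (Fin m) ℝ) : (t • A).rank ≤ A.rank := by
  rw [← Matrix.one_mul A, ← Matrix.smul_mul]
  exact (Matrix.rank_mul_le_right _ _).trans (by rw [Matrix.one_mul])

theorem smul_mem_rankSet {r : ℕ} {X : 𝕏} (hX : X ∈ rankSet 𝕏 r) (t : ℝ) : t • X ∈ rankSet 𝕏 r :=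
  (rank_smul_le t X.1).trans hX

theorem conj_isSymm {A P : Matrix (Fin n) (Fin n) ℝ} (hA : Aᵀ = A) :
    (P * A * Pᵀ)ᵀ = P * A * Pᵀ := by
  rw [Matrix.transpose_mul, Matrix.transpose_mul, Matrix.transpose_transpose, hA, Matrix.mul_assoc]

theorem conj_posSemidef {A : Matrix (Fin n) (Fin n) ℝ} (hA : A.PosSemidef)
    (P : Matrix (Fin n) (Fin n) ℝ) : (P * A * Pᵀ).PosSemidef := by
  simpa using hA.mul_mul_conjTranspose_same P

/-- A rank-`r` approximation in `ℝ^{n×m}`; the factor `2` only matches the symmetric case. -/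
theorem exists_mem_rankSet_fullSpace_norm_sub_le {r : ℕ} (hrn : r ≤ n) (hnm : n ≤ m)
    (X : FullSpace n m) :
    ∃ Z ∈ rankSet (FullSpace n m) r, ‖X - Z‖ ≤ 2 * (nuclearNorm X.1 - kyFanNorm r X.1) := by
  obtain ⟨P, -, -, hr, hP⟩ := exists_projection_norm_sub_le hrn hnm X.1
  refine ⟨⟨X.1 * P, trivial⟩, (Matrix.rank_mul_le_right _ _).trans hr, ?_⟩
  have := nuclearNorm_sub_kyFanNorm_nonneg hrn X.1
  exact le_trans hP (by linarith)

/-- A rank-`r` approximation of a symmetric matrix that preserves positive semidefiniteness. -/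
theorem exists_mem_rankSet_symSpace_norm_sub_le {r : ℕ} (hrn : r ≤ n) (X : SymSpace n) :
    ∃ Z ∈ rankSet (SymSpace n) r, (X ∈ psdCone n → Z ∈ psdCone n) ∧
      ‖X - Z‖ ≤ 2 * (nuclearNorm X.1 - kyFanNorm r X.1) := by
  obtain ⟨P, hPt, hPP, hr, hP⟩ := exists_projection_norm_sub_le hrn le_rfl X.1
  refine ⟨⟨P * X.1 * Pᵀ, conj_isSymm X.2⟩, ?_, fun hX => conj_posSemidef hX P, ?_⟩
  · exact ((Matrix.rank_mul_le_left _ _).trans (Matrix.rank_mul_le_left _ _)).trans hr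
  · have h := norm_sub_conj_le X.2 hPt hPP
    have h' : ‖X.1 - P * X.1 * Pᵀ‖ ≤ 2 * (nuclearNorm X.1 - kyFanNorm r X.1) := by
      rw [hPt]; linarith
    exact h'

theorem coe_inner_eq_trace (V W : 𝕏) : inner ℝ V W = (V.1ᵀ * W.1).trace := rfl

theorem matrix_eq_zero_of_trace {k l : ℕ} {A : Matrix (Fin k) (Fin l) ℝ}
    (h : (Aᵀ * A).trace = 0) : A = 0 := by
  rw [← norm_sq_eq_trace] at h
  simpa using h

theorem inner_eq_zero_of_mem_normalCone_rankSet {r : ℕ} {X V : 𝕏}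
    (hV : V ∈ limitingNormalCone (rankSet 𝕏 r) X) : inner ℝ V X = 0 := by
  apply inner_self_eq_zero_of_mem_limitingNormalCone (S := rankSet 𝕏 r)
  · intro Z hZ t _
    exact smul_mem_rankSet hZ t
  · exact hV

/-- Normals to the set of matrices of rank at most `r` annihilate the base point from both sides,
because `(1 + tH) Y` and `Y (1 + tH)` have rank at most that of `Y`. -/
theorem mul_transpose_eq_zero_of_mem_normalCone_rankSet {r : ℕ} {X V : FullSpace n n}
    (hV : V ∈ limitingNormalCone (rankSet (FullSpace n n) r) X) :
    V.1 * X.1ᵀ = 0 ∧ X.1ᵀ * V.1 = 0 := by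
  obtain ⟨y, w, hy, hyx, hwv, hw⟩ := hV
  have hy' : Tendsto (fun k => (y k).1) atTop (𝓝 X.1) :=
    (continuous_subtype_val.tendsto X).comp hyx
  have hw' : Tendsto (fun k => (w k).1) atTop (𝓝 V.1) :=
    (continuous_subtype_val.tendsto V).comp hwv
  have ht : Tendsto (fun k => (y k).1ᵀ) atTop (𝓝 X.1ᵀ) :=
    (continuous_id.matrix_transpose.tendsto X.1).comp hy'
  constructor
  · refine tendsto_nhds_unique (hw'.mul ht) (tendsto_const_nhds.congr fun k => Eq.symm ?_)
    apply matrix_eq_zero_of_trace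
    have h := inner_eq_zero_of_mem_regularNormalCone (hw k)
      (a := ⟨(w k).1 * (y k).1ᵀ * (y k).1, trivial⟩) (b := 0) fun t => by
        have e : (y k).1 + t • ((w k).1 * (y k).1ᵀ * (y k).1) + t ^ 2 • 0 =
            (1 + t • ((w k).1 * (y k).1ᵀ)) * (y k).1 := by
          rw [smul_zero, add_zero, Matrix.add_mul, Matrix.one_mul, Matrix.smul_mul]
        change ((y k).1 + t • ((w k).1 * (y k).1ᵀ * (y k).1) + t ^ 2 • 0).rank ≤ r
        rw [e]
        exact (Matrix.rank_mul_le_right _ _).trans (hy k)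
    rw [coe_inner_eq_trace] at h
    refine Eq.trans ?_ h
    rw [Matrix.transpose_mul, Matrix.transpose_transpose, Matrix.mul_assoc, Matrix.trace_mul_comm]
    simp only [Matrix.mul_assoc]
  · refine tendsto_nhds_unique (ht.mul hw') (tendsto_const_nhds.congr fun k => Eq.symm ?_)
    apply matrix_eq_zero_of_trace
    have h := inner_eq_zero_of_mem_regularNormalCone (hw k)
      (a := ⟨(y k).1 * ((y k).1ᵀ * (w k).1), trivial⟩) (b := 0) fun t => by
        have e : (y k).1 + t • ((y k).1 * ((y k).1ᵀ * (w k).1)) + t ^ 2 • 0 =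
            (y k).1 * (1 + t • ((y k).1ᵀ * (w k).1)) := by
          rw [smul_zero, add_zero, Matrix.mul_add, Matrix.mul_one, Matrix.mul_smul]
        change ((y k).1 + t • ((y k).1 * ((y k).1ᵀ * (w k).1)) + t ^ 2 • 0).rank ≤ r
        rw [e]
        exact (Matrix.rank_mul_le_left _ _).trans (hy k)
    rw [coe_inner_eq_trace] at h
    refine Eq.trans ?_ h
    rw [Matrix.transpose_mul, Matrix.transpose_transpose, Matrix.mul_assoc]

/-- Normals to the set of positive semidefinite matrices of rank at most `r` annihilate the base
point, because this set is invariant under the congruences `Y ↦ (1 + tH) Y (1 + tH)ᵀ`. -/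
theorem mul_eq_zero_of_mem_normalCone_psdRankSet {r : ℕ} {X V : SymSpace n}
    (hV : V ∈ limitingNormalCone (psdRankSet n r) X) : V.1 * X.1 = 0 := by
  obtain ⟨y, w, hy, hyx, hwv, hw⟩ := hV
  have hy' : Tendsto (fun k => (y k).1) atTop (𝓝 X.1) :=
    (continuous_subtype_val.tendsto X).comp hyx
  have hw' : Tendsto (fun k => (w k).1) atTop (𝓝 V.1) :=
    (continuous_subtype_val.tendsto V).comp hwv
  refine tendsto_nhds_unique (hw'.mul hy') (tendsto_const_nhds.congr fun k => Eq.symm ?_)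
  apply matrix_eq_zero_of_trace
  set Y := (y k).1 with hYdef
  set W := (w k).1 with hWdef
  have hY : Yᵀ = Y := (y k).2
  have hW : Wᵀ = W := (w k).2
  obtain ⟨H, hH⟩ : ∃ H : Matrix (Fin n) (Fin n) ℝ, H = W * Y := ⟨_, rfl⟩
  rw [← hH]
  have hsymm : (H * Y + Y * Hᵀ)ᵀ = H * Y + Y * Hᵀ := by
    rw [Matrix.transpose_add, Matrix.transpose_mul, Matrix.transpose_mul,
      Matrix.transpose_transpose, hY, add_comm]
  have h := inner_eq_zero_of_mem_regularNormalCone (hw k)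
    (a := ⟨H * Y + Y * Hᵀ, hsymm⟩) (b := ⟨H * Y * Hᵀ, conj_isSymm hY⟩) fun t => by
      have e : Y + t • (H * Y + Y * Hᵀ) + t ^ 2 • (H * Y * Hᵀ) =
          (1 + t • H) * Y * (1 + t • H)ᵀ := by
        rw [Matrix.transpose_add, Matrix.transpose_one, Matrix.transpose_smul, Matrix.mul_add,
          Matrix.mul_one, Matrix.mul_smul, Matrix.add_mul, Matrix.one_mul, Matrix.smul_mul,
          Matrix.add_mul, Matrix.smul_mul]
        module
      change (Y + t • (H * Y + Y * Hᵀ) + t ^ 2 • (H * Y * Hᵀ)).PosSemidef ∧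
        (Y + t • (H * Y + Y * Hᵀ) + t ^ 2 • (H * Y * Hᵀ)).rank ≤ r
      rw [e]
      exact ⟨conj_posSemidef (hy k).1 _, ((Matrix.rank_mul_le_left _ _).trans
        (Matrix.rank_mul_le_right _ _)).trans (hy k).2⟩
  rw [coe_inner_eq_trace] at h
  have h1 : (Wᵀ * (H * Y + Y * Hᵀ)).trace = 2 * (Hᵀ * H).trace := by
    have e1 : (Wᵀ * (H * Y)).trace = (Hᵀ * H).trace := by
      rw [hH, Matrix.transpose_mul, hW, hY, ← Matrix.mul_assoc, Matrix.trace_mul_comm]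
      simp only [Matrix.mul_assoc]
    have e2 : (Wᵀ * (Y * Hᵀ)).trace = (Hᵀ * H).trace := by
      rw [hW, ← Matrix.mul_assoc, Matrix.trace_mul_comm, ← hH]
    rw [Matrix.mul_add, Matrix.trace_add, e1, e2]; ring
  change (Wᵀ * (H * Y + Y * Hᵀ)).trace = 0 at h
  linarith

theorem qualification_of_forall {E : Type*} [NormedAddCommGroup E] [InnerProductSpace ℝ E]
    {A B : Set E} {x : E} (hA : x ∈ A) (hB : x ∈ B)
    (h : ∀ v, -v ∈ limitingNormalCone A x → v ∈ limitingNormalCone B x → v = 0) :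
    (-limitingNormalCone A x) ∩ limitingNormalCone B x = {0} := by
  refine Set.eq_singleton_iff_unique_mem.2 ⟨⟨?_, zero_mem_limitingNormalCone hB⟩, fun v hv =>
    h v hv.1 hv.2⟩
  rw [Set.mem_neg, neg_zero]
  exact zero_mem_limitingNormalCone hA

/-- The first criterion and calmness in a matrix space admitting rank-`r` truncations. -/
theorem firstCriterion_and_calm {r : ℕ} (hrn : r ≤ n) {Ω : Set 𝕏} (hΩ : IsClosed Ω)
    (htrunc : ∀ X : 𝕏, ∃ Z ∈ rankSet 𝕏 r, ‖X - Z‖ ≤ 2 * (nuclearNorm X.1 - kyFanNorm r X.1))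
    (h : ∀ X ∈ Ω, ∀ V : 𝕏, -V ∈ limitingNormalCone Ω X →
      V ∈ limitingNormalCone (rankSet 𝕏 r) X → V = 0) :
    FirstCriterion Ω r ∧ PerturbationCalm Ω r := by
  have hC : FirstCriterion Ω r := fun X hX =>
    qualification_of_forall hX.1 hX.2 (h X hX.1)
  exact ⟨hC, perturbationCalm_of_qualification hrn hΩ (isClosed_rankSet 𝕏 r) subset_rfl rfl hC
    fun X _ => htrunc X⟩

/-- The second criterion and calmness for a closed convex set `Ξ`: it suffices that `V X = 0` and
`⟨V, Z - X⟩ ≥ 0` for all `Z ∈ Ξ` force `V = 0`. -/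
theorem secondCriterion_and_calm {r : ℕ} (hrn : r ≤ n) {Ξ : Set (SymSpace n)} (hΞ : IsClosed Ξ)
    (hconv : Convex ℝ Ξ)
    (h : ∀ X ∈ Ξ, ∀ V : SymSpace n, (∀ Z ∈ Ξ, 0 ≤ inner ℝ V (Z - X)) → V.1 * X.1 = 0 → V = 0) :
    SecondCriterion Ξ r ∧ PerturbationCalm (psdCone n ∩ Ξ) r := by
  have hC : SecondCriterion Ξ r := fun X hX =>
    qualification_of_forall hX.1.2 ⟨hX.1.1, hX.2⟩ fun V hV hV' =>
      h X hX.1.2 V (fun Z hZ => by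
        have := inner_sub_nonpos_of_mem_limitingNormalCone hconv hV hZ
        rw [inner_neg_left] at this
        linarith) (mul_eq_zero_of_mem_normalCone_psdRankSet hV')
  refine ⟨hC, perturbationCalm_of_qualification hrn hΞ (isClosed_psdRankSet n r)
    Set.inter_subset_right ?_ hC fun X hX => ?_⟩
  · ext X
    exact ⟨fun hX => ⟨⟨hX.2.1, hX.1⟩, hX.2.2⟩, fun hX => ⟨hX.1.2, hX.1.1, hX.2⟩⟩
  · obtain ⟨Z, hZ, hZp, hXZ⟩ := exists_mem_rankSet_symSpace_norm_sub_le hrn X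
    exact ⟨Z, ⟨hZp hX.1, hZ⟩, hXZ⟩

end Calmness

/-! ### Norm balls and Frobenius spheres -/

section BallsAndSpheres

theorem eq_smul_of_mem_normalCone_sphere {E : Type*} [NormedAddCommGroup E]
    [InnerProductSpace ℝ E] {ϱ : ℝ} (hϱ : 0 < ϱ) {x v : E}
    (hv : v ∈ limitingNormalCone {z : E | ‖z‖ = ϱ} x) : v = (inner ℝ v x / ϱ ^ 2) • x := by
  obtain ⟨y, w, hy, hyx, hwv, hw⟩ := hv
  have hreg : ∀ k, w k = (inner ℝ (w k) (y k) / ϱ ^ 2) • y k := by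
    intro k
    have hyk : ‖y k‖ = ϱ := hy k
    by_contra hne
    set p : E := w k - (inner ℝ (w k) (y k) / ϱ ^ 2) • y k with hp
    have hp0 : 0 < ‖p‖ := norm_pos_iff.2 (sub_ne_zero.2 hne)
    have hyp : inner ℝ (y k) p = 0 := by
      rw [hp, inner_sub_right, inner_smul_right, real_inner_self_eq_norm_sq, hyk,
        real_inner_comm]
      field_simp
      ring
    have hwp : inner ℝ (w k) p = ‖p‖ ^ 2 := by
      have h1 : w k = p + (inner ℝ (w k) (y k) / ϱ ^ 2) • y k := by rw [hp]; abel
      rw [← real_inner_self_eq_norm_sq]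
      conv_lhs => rw [h1]
      rw [inner_add_left, real_inner_smul_left, hyp, mul_zero, add_zero]
    -- move along the great circle through `y k` in the direction of the tangential part `p`
    set u : E := (ϱ / ‖p‖) • p with hu
    have hnu : ‖u‖ = ϱ := by
      rw [hu, norm_smul, Real.norm_of_nonneg (by positivity)]; field_simp
    have hyu : inner ℝ (y k) u = 0 := by rw [hu, inner_smul_right, hyp, mul_zero]
    have hd : HasDerivAt (fun t : ℝ => Real.cos t • y k + Real.sin t • u) u 0 := by
      have h1 := ((Real.hasDerivAt_cos 0).smul_const (y k)).add
        ((Real.hasDerivAt_sin 0).smul_const u)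
      rw [Real.sin_zero, Real.cos_zero, neg_zero, zero_smul, zero_add, one_smul] at h1
      exact h1
    have h := inner_nonpos_of_mem_regularNormalCone (hw k) (by simp) hd
      (Eventually.of_forall fun t => by
        have h2 : ‖Real.cos t • y k + Real.sin t • u‖ ^ 2 = ϱ ^ 2 := by
          rw [norm_add_sq_real, norm_smul, norm_smul, mul_pow, mul_pow, hyk, hnu,
            real_inner_smul_left, inner_smul_right, hyu, Real.norm_eq_abs, Real.norm_eq_abs,
            sq_abs, sq_abs]
          linear_combination ϱ ^ 2 * Real.cos_sq_add_sin_sq t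
        exact (sq_eq_sq₀ (norm_nonneg _) hϱ.le).1 h2)
    rw [hu, inner_smul_right, hwp] at h
    have : 0 < ϱ / ‖p‖ * ‖p‖ ^ 2 := by positivity
    linarith
  have hlim : Tendsto (fun k => (inner ℝ (w k) (y k) / ϱ ^ 2) • y k) atTop
      (𝓝 ((inner ℝ v x / ϱ ^ 2) • x)) := ((hwv.inner hyx).div_const _).smul hyx
  exact tendsto_nhds_unique hwv (hlim.congr fun k => (hreg k).symm)

variable {n m : ℕ} {𝕏 : Submodule ℝ (Matrix (Fin n) (Fin m) ℝ)}

/-- Stated for the scalar action of the submodule `𝕏`, which `rw` does not identify with the one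
coming from its inner product structure. -/
theorem inner_smul_right_coe (V W : 𝕏) (t : ℝ) : inner ℝ V (t • W) = t * inner ℝ V W :=
  inner_smul_right V W t

theorem inner_smul_left_coe (V W : 𝕏) (t : ℝ) : inner ℝ (t • V) W = t * inner ℝ V W :=
  real_inner_smul_left V W t

theorem eq_zero_of_inner_self_nonpos {E : Type*} [NormedAddCommGroup E] [InnerProductSpace ℝ E]
    {v : E} (h : inner ℝ v v ≤ 0) : v = 0 :=
  inner_self_eq_zero.1 (le_antisymm h real_inner_self_nonneg)

theorem isClosed_normBall (p : Seminorm ℝ 𝕏) (ϱ : ℝ) : IsClosed (normBall p ϱ) := by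
  have h : Continuous p :=
    continuousOn_univ.1 (p.convexOn.continuousOn isOpen_univ)
  exact isClosed_le h continuous_const

theorem convex_normBall (p : Seminorm ℝ 𝕏) (ϱ : ℝ) : Convex ℝ (normBall p ϱ) := by
  have := p.convexOn.convex_le ϱ
  simpa [normBall] using this

/-- A ball of positive radius around the origin is absorbing, so that no nonzero functional is
nonnegative on it. -/
theorem eq_zero_of_forall_normBall_inner_nonneg {p : Seminorm ℝ 𝕏} {ϱ : ℝ} (hϱ : 0 < ϱ) {V : 𝕏}
    (h : ∀ Z ∈ normBall p ϱ, 0 ≤ inner ℝ V Z) : V = 0 := by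
  have hp : 0 ≤ p V := apply_nonneg p V
  set t : ℝ := ϱ / (p V + 1) with ht
  have ht0 : 0 < t := by positivity
  have hmem : (-t) • V ∈ normBall p ϱ := by
    change p ((-t) • V) ≤ ϱ
    rw [map_smul_eq_mul, norm_neg, Real.norm_of_nonneg ht0.le, ht, div_mul_eq_mul_div,
      div_le_iff₀ (by positivity)]
    nlinarith
  have h1 := h _ hmem
  rw [inner_smul_right_coe] at h1
  exact eq_zero_of_inner_self_nonpos (by nlinarith)

theorem firstCriterion_and_calm_normBall {r : ℕ} (hrn : r ≤ n)
    (htrunc : ∀ X : 𝕏, ∃ Z ∈ rankSet 𝕏 r, ‖X - Z‖ ≤ 2 * (nuclearNorm X.1 - kyFanNorm r X.1))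
    (p : Seminorm ℝ 𝕏) {ϱ : ℝ} (hϱ : 0 < ϱ) :
    FirstCriterion (normBall p ϱ) r ∧ PerturbationCalm (normBall p ϱ) r := by
  refine firstCriterion_and_calm hrn (isClosed_normBall p ϱ) htrunc fun X _ V hV hV' => ?_
  refine eq_zero_of_forall_normBall_inner_nonneg (p := p) hϱ fun Z hZ => ?_
  have h1 := inner_sub_nonpos_of_mem_limitingNormalCone (convex_normBall p ϱ) hV hZ
  rw [inner_neg_left, inner_sub_right, inner_eq_zero_of_mem_normalCone_rankSet hV'] at h1
  linarith

theorem secondCriterion_and_calm_normBall {r : ℕ} (hrn : r ≤ n) (p : Seminorm ℝ (SymSpace n))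
    {ϱ : ℝ} (hϱ : 0 < ϱ) :
    SecondCriterion (normBall p ϱ) r ∧ PerturbationCalm (psdCone n ∩ normBall p ϱ) r := by
  refine secondCriterion_and_calm hrn (isClosed_normBall p ϱ) (convex_normBall p ϱ)
    fun X _ V hV hVX => ?_
  refine eq_zero_of_forall_normBall_inner_nonneg (p := p) hϱ fun Z hZ => ?_
  have hV' : V.1ᵀ = V.1 := V.2
  have h0 : inner ℝ V X = 0 := by rw [coe_inner_eq_trace, hV', hVX, Matrix.trace_zero]
  have h1 := hV Z hZ
  rwa [inner_sub_right, h0, sub_zero] at h1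

theorem firstCriterion_and_calm_frobeniusSphere {r : ℕ} (hrn : r ≤ n)
    (htrunc : ∀ X : 𝕏, ∃ Z ∈ rankSet 𝕏 r, ‖X - Z‖ ≤ 2 * (nuclearNorm X.1 - kyFanNorm r X.1))
    {ϱ : ℝ} (hϱ : 0 < ϱ) :
    FirstCriterion (frobeniusSphere 𝕏 ϱ) r ∧ PerturbationCalm (frobeniusSphere 𝕏 ϱ) r := by
  refine firstCriterion_and_calm hrn (isClosed_eq continuous_norm continuous_const) htrunc
    fun X _ V hV hV' => ?_
  have h := eq_smul_of_mem_normalCone_sphere hϱ hV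
  rw [inner_neg_left, inner_eq_zero_of_mem_normalCone_rankSet hV', neg_zero, zero_div,
    zero_smul] at h
  exact neg_eq_zero.1 h

end BallsAndSpheres

/-! ### Affine constraints in the symmetric matrices -/

section Affine

variable {n : ℕ}

/-- The second criterion and calmness for an affine set: it suffices that `V X = 0` and
orthogonality of `V` to the direction space force `V = 0`. -/
theorem secondCriterion_and_calm_of_affine {ι : Type*} {r : ℕ} (hrn : r ≤ n)
    (f : ι → SymSpace n →ₗ[ℝ] ℝ) (c : ι → ℝ) {Ξ : Set (SymSpace n)}
    (hΞ : ∀ X, X ∈ Ξ ↔ ∀ i, f i X = c i)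
    (h : ∀ X ∈ Ξ, ∀ V : SymSpace n, (∀ W, (∀ i, f i W = 0) → inner ℝ V W = 0) →
      V.1 * X.1 = 0 → V = 0) :
    SecondCriterion Ξ r ∧ PerturbationCalm (psdCone n ∩ Ξ) r := by
  have hΞ' : Ξ = ⋂ i, {X | f i X = c i} := by
    ext X
    rw [Set.mem_iInter]
    exact hΞ X
  refine secondCriterion_and_calm hrn ?_ ?_ fun X hX V hV => h X hX V fun W hW => ?_
  · rw [hΞ']
    exact isClosed_iInter fun i =>
      isClosed_eq (f i).continuous_of_finiteDimensional continuous_const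
  · rw [hΞ']
    exact convex_iInter fun i => convex_hyperplane (f i).isLinear (c i)
  · have hX' := (hΞ X).1 hX
    have h1 := hV (X + W) ((hΞ _).2 fun i => by rw [map_add, hX', hW, add_zero])
    have h2 := hV (X - W) ((hΞ _).2 fun i => by rw [map_sub, hX', hW, sub_zero])
    rw [add_sub_cancel_left] at h1
    rw [sub_sub_cancel_left, inner_neg_right] at h2
    linarith

/-- The entry `X i j` as a linear functional of `X`. -/
def symEntry (i j : Fin n) : SymSpace n →ₗ[ℝ] ℝ :=
  Matrix.entryLinearMap ℝ ℝ i j ∘ₗ (SymSpace n).subtype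

theorem symEntry_apply (i j : Fin n) (X : SymSpace n) : symEntry i j X = X.1 i j := rfl

/-- The symmetric matrix `E_ij + E_ji`. -/
def symSingle (i j : Fin n) : SymSpace n :=
  ⟨Matrix.single i j 1 + Matrix.single j i 1, by
    change (_ + _)ᵀ = _
    rw [Matrix.transpose_add, Matrix.transpose_single, Matrix.transpose_single, add_comm]⟩

theorem symSingle_apply (i j a b : Fin n) :
    (symSingle i j).1 a b =
      (if i = a ∧ j = b then 1 else 0) + (if j = a ∧ i = b then 1 else 0) := by
  simp [symSingle, Matrix.single_apply]

theorem inner_eq_sum {m : ℕ} {𝕏 : Submodule ℝ (Matrix (Fin n) (Fin m) ℝ)} (V W : 𝕏) :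
    inner ℝ V W = ∑ i, ∑ j, V.1 i j * W.1 i j := by
  rw [coe_inner_eq_trace, Finset.sum_comm]
  simp [Matrix.trace, Matrix.mul_apply]

theorem inner_symSingle (V : SymSpace n) (i j : Fin n) :
    inner ℝ V (symSingle i j) = 2 * V.1 i j := by
  have hV : V.1 j i = V.1 i j := congrFun (congrFun V.2 i) j
  rw [inner_eq_sum]
  simp only [symSingle_apply, mul_add, Finset.sum_add_distrib, ite_and, mul_ite, mul_one, mul_zero,
    Finset.sum_ite_irrel, Finset.sum_ite_eq, Finset.sum_const_zero, Finset.mem_univ, if_true, hV]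
  ring

theorem secondCriterion_and_calm_unitDiagonalSet {r : ℕ} (hrn : r ≤ n) :
    SecondCriterion (unitDiagonalSet n) r ∧
      PerturbationCalm (psdCone n ∩ unitDiagonalSet n) r := by
  refine secondCriterion_and_calm_of_affine hrn (fun i => symEntry i i) (fun _ => 1)
    (fun X => Iff.rfl) fun X hX V hV hVX => ?_
  have hoff : ∀ i j, i ≠ j → V.1 i j = 0 := fun i j hij => by
    have := hV (symSingle i j) fun a => by
      rw [symEntry_apply, symSingle_apply]
      grind
    rw [inner_symSingle] at this
    linarith
  apply Subtype.ext
  ext i j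
  rcases eq_or_ne i j with rfl | hij
  · have h := congrFun (congrFun hVX i) i
    rw [Matrix.mul_apply, Finset.sum_eq_single i (fun b _ hb => by rw [hoff i b hb.symm, zero_mul])
      (by simp), hX i, mul_one] at h
    exact h
  · exact hoff i j hij

theorem mem_span_of_forall_inner_eq_zero {ι : Type*} {E : Type*} [NormedAddCommGroup E]
    [InnerProductSpace ℝ E] [FiniteDimensional ℝ E] {A : ι → E} {v : E}
    (h : ∀ w, (∀ i, inner ℝ (A i) w = 0) → inner ℝ v w = 0) :
    v ∈ Submodule.span ℝ (Set.range A) := by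
  rw [← Submodule.orthogonal_orthogonal (Submodule.span ℝ (Set.range A)),
    Submodule.mem_orthogonal']
  exact fun w hw => h w fun i =>
    (Submodule.mem_orthogonal _ _).1 hw _ (Submodule.subset_span ⟨i, rfl⟩)

theorem secondCriterion_and_calm_traceHyperplane_inter {r : ℕ} (hrn : r ≤ n) {b₁ b₂ : ℝ}
    {B C : SymSpace n} (hb₂ : b₂ ≠ 0) (hBC : IsUnit (B.1 - (b₁ / b₂) • C.1)) :
    SecondCriterion (traceHyperplane B b₁ ∩ traceHyperplane C b₂) r ∧
      PerturbationCalm (psdCone n ∩ (traceHyperplane B b₁ ∩ traceHyperplane C b₂)) r := by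
  refine secondCriterion_and_calm_of_affine hrn (fun i : Fin 2 => (innerₛₗ ℝ (![B, C] i)))
    ![b₁, b₂] (fun X => ?_) fun X hX V hV hVX => ?_
  · rw [Fin.forall_fin_two]; rfl
  · have hspan := mem_span_of_forall_inner_eq_zero (A := ![B, C]) hV
    obtain ⟨c, hc⟩ := (Submodule.mem_span_range_iff_exists_fun ℝ).1 hspan
    rw [Fin.sum_univ_two] at hc
    change c 0 • B + c 1 • C = V at hc
    have hX1 : inner ℝ B X = b₁ := hX.1
    have hX2 : inner ℝ C X = b₂ := hX.2
    have hV' : V.1ᵀ = V.1 := V.2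
    have h0 : inner ℝ V X = 0 := by rw [coe_inner_eq_trace, hV', hVX, Matrix.trace_zero]
    rw [← hc, inner_add_left, inner_smul_left_coe, inner_smul_left_coe, hX1, hX2] at h0
    have hc1 : c 1 = -(c 0 * (b₁ / b₂)) := by field_simp; linarith
    have hVeq : V.1 = c 0 • (B.1 - (b₁ / b₂) • C.1) := by
      rw [← hc, hc1]
      change c 0 • B.1 + (-(c 0 * (b₁ / b₂))) • C.1 = _
      module
    have hc0 : c 0 = 0 := by
      by_contra hne
      have h1 : (B.1 - (b₁ / b₂) • C.1) * X.1 = 0 := by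
        rw [hVeq, Matrix.smul_mul] at hVX
        exact (smul_eq_zero.1 hVX).resolve_left hne
      have h2 : X = 0 := Subtype.ext ((hBC.mul_right_eq_zero).1 h1)
      rw [h2, inner_zero_right] at hX2
      exact hb₂ hX2.symm
    apply Subtype.ext
    rw [hVeq, hc0, zero_smul]
    rfl

theorem secondCriterion_and_calm_traceHyperplane {r : ℕ} (hrn : r ≤ n) {b : ℝ}
    {C : SymSpace n} (hb : b ≠ 0) :
    SecondCriterion (traceHyperplane C b) r ∧
      PerturbationCalm (psdCone n ∩ traceHyperplane C b) r := by
  refine secondCriterion_and_calm_of_affine hrn (fun _ : Unit => innerₛₗ ℝ C)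
    (fun _ => b) (fun X => ?_) fun X hX V hV hVX => ?_
  · rw [forall_const]; rfl
  · have hspan := mem_span_of_forall_inner_eq_zero (A := fun _ : Unit => C) hV
    rw [Set.range_const, Submodule.mem_span_singleton] at hspan
    obtain ⟨c, rfl⟩ := hspan
    have hX' : inner ℝ C X = b := hX
    have hV' : (c • C).1ᵀ = (c • C).1 := (c • C).2
    have h0 : inner ℝ (c • C) X = 0 := by rw [coe_inner_eq_trace, hV', hVX, Matrix.trace_zero]
    rw [inner_smul_left_coe, hX'] at h0
    rw [(mul_eq_zero.1 h0).resolve_right hb, zero_smul]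

theorem secondCriterion_and_calm_zeroOneSet {r : ℕ} (hrn : r ≤ n) (hn : 0 < n) :
    SecondCriterion (zeroOneSet n hn) r ∧ PerturbationCalm (psdCone n ∩ zeroOneSet n hn) r := by
  set o : Fin n := ⟨0, hn⟩ with ho
  refine secondCriterion_and_calm_of_affine hrn
    (fun i => if i = o then symEntry o o else
      symEntry i i - (1 / 2 : ℝ) • (symEntry o i + symEntry i o))
    (fun i => if i = o then 1 else 0) (fun X => ?_) fun X hX V hV hVX => ?_
  · constructor
    · rintro ⟨h0, h1⟩ i
      by_cases hi : i = o
      · rw [if_pos hi, if_pos hi]; exact h0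
      · rw [if_neg hi, if_neg hi]; exact h1 i hi
    · intro h
      refine ⟨?_, fun i hi => ?_⟩
      · have := h o
        rwa [if_pos rfl, if_pos rfl] at this
      · have := h i
        rwa [if_neg hi, if_neg hi] at this
  · have hX0 : X.1 o o = 1 := hX.1
    have hXs : ∀ i j, X.1 j i = X.1 i j := fun i j => congrFun (congrFun X.2 i) j
    have hVs : ∀ i j, V.1 j i = V.1 i j := fun i j => congrFun (congrFun V.2 i) j
    have hXi : ∀ i, i ≠ o → X.1 i i = X.1 i o := fun i hi => by
      have h := hX.2 i hi
      rw [← ho, hXs i o] at h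
      linarith
    -- the direction `E_ij + E_ji`
    have hoff : ∀ i j, i ≠ o → j ≠ o → i ≠ j → V.1 i j = 0 := fun i j hi hj hij => by
      have := hV (symSingle i j) fun a => by
        by_cases ha : a = o
        · rw [if_pos ha, symEntry_apply, symSingle_apply]; grind
        · rw [if_neg ha]
          simp only [LinearMap.sub_apply, LinearMap.smul_apply, LinearMap.add_apply,
            symEntry_apply, symSingle_apply, smul_eq_mul]
          grind
      rw [inner_symSingle] at this
      linarith
    -- twice the direction `E_ii + E_1i + E_i1`
    have hdiag : ∀ i, i ≠ o → V.1 i i + 2 * V.1 i o = 0 := fun i hi => by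
      have := hV (symSingle i i + (2 : ℝ) • symSingle i o) fun a => by
        by_cases ha : a = o
        · rw [if_pos ha, map_add, map_smul, symEntry_apply, symEntry_apply, symSingle_apply,
            symSingle_apply, smul_eq_mul]
          grind
        · rw [if_neg ha, map_add, map_smul]
          simp only [LinearMap.sub_apply, LinearMap.smul_apply, LinearMap.add_apply,
            symEntry_apply, symSingle_apply, smul_eq_mul]
          grind
      rw [inner_add_right, inner_smul_right_coe, inner_symSingle, inner_symSingle] at this
      linarith
    have hprod : ∀ i j, i ≠ o → V.1 i o * X.1 o j + V.1 i i * X.1 i j = 0 := fun i j hi => by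
      have h := congrFun (congrFun hVX i) j
      rw [Matrix.mul_apply, ← Finset.sum_subset (Finset.subset_univ {o, i}),
        Finset.sum_pair (Ne.symm hi)] at h
      · exact h
      · intro k _ hk
        rw [hoff i k hi (by grind) (by grind), zero_mul]
    -- with `s = V_ii` and `x = X_ii = X_i1`, the entries `(i, 1)` and `(i, i)` of `V X = 0` read
    -- `s (x - 1/2) = 0` and `s x / 2 = 0`
    have hii : ∀ i, i ≠ o → V.1 i i = 0 := fun i hi => by
      have h1 := hprod i o hi
      have h2 := hprod i i hi
      rw [hX0] at h1
      rw [hXi i hi, hXs i o] at h2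
      have h3 := hdiag i hi
      have h4 : V.1 i o = -(V.1 i i / 2) := by linarith
      rw [h4] at h1 h2
      have h5 : V.1 i i * X.1 i o = 0 := by linarith
      linarith
    have hio : ∀ i, i ≠ o → V.1 i o = 0 := fun i hi => by
      have := hdiag i hi
      rw [hii i hi] at this
      linarith
    have hoo : V.1 o o = 0 := by
      have h := congrFun (congrFun hVX o) o
      rw [Matrix.mul_apply, Finset.sum_eq_single o (fun b _ hb => by
        rw [hVs b o, hio b hb, zero_mul]) (by simp), hX0, mul_one] at h
      exact h
    apply Subtype.ext
    ext i j
    change V.1 i j = 0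
    by_cases hi : i = o
    · by_cases hj : j = o
      · rw [hi, hj, hoo]
      · rw [hi, hVs j o, hio j hj]
    · by_cases hj : j = o
      · rw [hj, hio i hi]
      · by_cases hij : i = j
        · rw [← hij, hii i hi]
        · exact hoff i j hi hj hij

theorem secondCriterion_and_calm_blockOrthogonalSet {r k p : ℕ} (hrn : r ≤ n) (hn : 0 < n)
    (h : k * p = n) :
    SecondCriterion (blockOrthogonalSet h) r ∧
      PerturbationCalm (psdCone n ∩ blockOrthogonalSet h) r := by
  let e : Fin k × Fin p ≃ Fin n := finProdFinEquiv.trans (finCongr h)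
  have hblock : ∀ (X : Matrix (Fin n) (Fin n) ℝ) i j,
      (block h X i j).trace = ∑ a, X (e (i, a)) (e (j, a)) := fun X i j => rfl
  have hsum : ∀ F : Fin n → ℝ, ∑ s, F s = ∑ i, ∑ a, F (e (i, a)) := fun F => by
    rw [← e.sum_comp, Fintype.sum_prod_type]
  have hp : (p : ℝ) ≠ 0 := by
    rintro hp
    rw [Nat.cast_eq_zero] at hp
    subst hp
    omega
  refine secondCriterion_and_calm_of_affine hrn
    (fun q : Fin k × Fin k => ∑ a, symEntry (e (q.1, a)) (e (q.2, a)))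
    (fun q => if q.1 = q.2 then 1 else 0) (fun X => ?_) fun X hX V hV hVX => ?_
  · simp only [LinearMap.sum_apply, symEntry_apply, Prod.forall]
    constructor
    · rintro ⟨h1, h2⟩ i j
      rcases eq_or_ne i j with rfl | hij
      · simpa [hblock] using h1 i
      · simpa [hij, hblock] using h2 i j hij
    · intro h1
      refine ⟨fun i => ?_, fun i j hij => ?_⟩
      · simpa [hblock] using h1 i i
      · simpa [hij, hblock] using h1 i j
  · have hVs : ∀ i j, V.1 j i = V.1 i j := fun i j => congrFun (congrFun V.2 i) j
    have hXb : ∀ i j, ∑ a, X.1 (e (i, a)) (e (j, a)) = if i = j then 1 else 0 := fun i j => by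
      rcases eq_or_ne i j with rfl | hij
      · simpa [hblock] using hX.1 i
      · simpa [hij, hblock] using hX.2 i j hij
    -- `K = Y ⊗ I` is the orthogonal projection of `V` onto the normal space
    let Y : Fin k → Fin k → ℝ := fun i j => (∑ a, V.1 (e (i, a)) (e (j, a))) / p
    let K : Matrix (Fin n) (Fin n) ℝ := Matrix.of fun s t =>
      if (e.symm s).2 = (e.symm t).2 then Y (e.symm s).1 (e.symm t).1 else 0
    have hK : ∀ i a j b, K (e (i, a)) (e (j, b)) = if a = b then Y i j else 0 := fun i a j b => by
      simp [K]
    have hKs : Kᵀ = K := by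
      ext s t
      obtain ⟨⟨i, a⟩, rfl⟩ := e.surjective s
      obtain ⟨⟨j, b⟩, rfl⟩ := e.surjective t
      rw [Matrix.transpose_apply, hK, hK]
      have hY : Y j i = Y i j := by
        simp only [Y]
        congr 1
        exact Finset.sum_congr rfl fun a _ => hVs _ _
      rw [hY]
      simp only [eq_comm]
    let W : SymSpace n := V - ⟨K, hKs⟩
    have hW : ∀ s t, W.1 s t = V.1 s t - K s t := fun s t => rfl
    have hWb : ∀ i j, ∑ a, W.1 (e (i, a)) (e (j, a)) = 0 := fun i j => by
      simp only [hW, hK, Finset.sum_sub_distrib, if_true, Finset.sum_const, Finset.card_univ,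
        Fintype.card_fin, nsmul_eq_mul, Y]
      field_simp
      ring
    have hVW : inner ℝ V W = 0 := hV W fun q => by
      simpa only [LinearMap.sum_apply, symEntry_apply] using hWb q.1 q.2
    have hKW : inner ℝ (⟨K, hKs⟩ : SymSpace n) W = 0 := by
      rw [inner_eq_sum, hsum]
      simp only [hsum, hK, ite_mul, zero_mul, Finset.sum_ite_eq, Finset.mem_univ, if_true]
      refine Finset.sum_eq_zero fun i _ => ?_
      rw [Finset.sum_comm]
      refine Finset.sum_eq_zero fun j _ => ?_
      rw [← Finset.mul_sum, hWb, mul_zero]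
    have hW0 : W = 0 := by
      have h1 : inner ℝ (V - ⟨K, hKs⟩) W = 0 := by rw [inner_sub_left, hVW, hKW, sub_zero]
      exact eq_zero_of_inner_self_nonpos h1.le
    have hVK : V.1 = K := by
      have := sub_eq_zero.1 (show V - (⟨K, hKs⟩ : SymSpace n) = 0 from hW0)
      rw [this]
    -- the block traces of `V X = (Y ⊗ I) X` are the entries of `Y`, since those of `X` are `δ_ij`
    have hY0 : ∀ i j, Y i j = 0 := fun i j => by
      have h1 : ∑ a, (V.1 * X.1) (e (i, a)) (e (j, a)) = 0 := by simp [hVX]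
      rw [hVK] at h1
      simp only [Matrix.mul_apply, hsum, hK, ite_mul, zero_mul, Finset.sum_ite_eq,
        Finset.mem_univ, if_true] at h1
      rw [Finset.sum_comm] at h1
      simp only [← Finset.mul_sum, hXb] at h1
      simpa using h1
    apply Subtype.ext
    rw [hVK]
    ext s t
    obtain ⟨⟨i, a⟩, rfl⟩ := e.surjective s
    obtain ⟨⟨j, b⟩, rfl⟩ := e.surjective t
    rw [hK, hY0, ite_self]
    rfl

end Affine

/-! ### Stochastic matrices -/

section Stochastic

variable {n : ℕ}

/-- If `V` has zero column sums and is nonnegative as a functional on `Ω`, then moving from the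
barycentre `e eᵀ / n` in the direction `-W` inside `Ω` shows `⟨V, W⟩ ≤ 0`. -/
theorem inner_nonpos_of_barycentre (hn : 0 < n) {Ω : Set (FullSpace n n)} {V W : FullSpace n n}
    (hcol : ∀ j, ∑ i, V.1 i j = 0) (hV : ∀ Z ∈ Ω, 0 ≤ inner ℝ V Z)
    (hΩ : ∀ t : ℝ, (∀ i j, 0 ≤ (1 : ℝ) / n - t * W.1 i j) →
      (⟨Matrix.of fun i j => (1 : ℝ) / n - t * W.1 i j, trivial⟩ : FullSpace n n) ∈ Ω) :
    inner ℝ V W ≤ 0 := by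
  have hn' : (0 : ℝ) < 1 / n := by positivity
  have hev : ∀ᶠ t : ℝ in 𝓝[>] 0, ∀ i j, 0 ≤ (1 : ℝ) / n - t * W.1 i j := by
    refine eventually_all.2 fun i => eventually_all.2 fun j => ?_
    have hc : ContinuousAt (fun t : ℝ => (1 : ℝ) / n - t * W.1 i j) 0 := by fun_prop
    have := hc.eventually (lt_mem_nhds (a := 0) (by simpa using hn'))
    exact (this.filter_mono nhdsWithin_le_nhds).mono fun t ht => ht.le
  obtain ⟨t, ht, ht0⟩ := (hev.and self_mem_nhdsWithin).exists
  have ht0' : (0 : ℝ) < t := ht0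
  have h := hV _ (hΩ t ht)
  rw [inner_eq_sum] at h
  have h1 : ∑ i, ∑ j, V.1 i j * ((1 : ℝ) / n - t * W.1 i j) = -(t * inner ℝ V W) := by
    have h2 : ∑ i, ∑ j, V.1 i j * ((1 : ℝ) / n) = 0 := by
      rw [Finset.sum_comm]
      exact Finset.sum_eq_zero fun j _ => by rw [← Finset.sum_mul, hcol, zero_mul]
    simp only [mul_sub, Finset.sum_sub_distrib, h2, zero_sub, inner_eq_sum, Finset.mul_sum]
    congr 1
    exact Finset.sum_congr rfl fun i _ => Finset.sum_congr rfl fun j _ => by ring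
  have h3 : (0 : ℝ) ≤ -(t * inner ℝ V W) := h1 ▸ h
  nlinarith

theorem mem_rowStochasticSet {X : FullSpace n n} :
    X ∈ rowStochasticSet n ↔ (∀ i j, 0 ≤ X.1 i j) ∧ ∀ i, ∑ j, X.1 i j = 1 := by
  refine and_congr_right fun _ => ?_
  rw [funext_iff]
  simp [Matrix.mulVec, dotProduct]

theorem mem_doublyStochasticSet {X : FullSpace n n} :
    X ∈ doublyStochasticSet n ↔ X ∈ rowStochasticSet n ∧ ∀ j, ∑ i, X.1 i j = 1 := by
  rw [mem_rowStochasticSet, and_assoc]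
  refine and_congr_right fun _ => ?_
  rw [funext_iff, funext_iff]
  simp [Matrix.mulVec, dotProduct]

theorem isClosed_rowStochasticSet : IsClosed (rowStochasticSet n) := by
  have h : rowStochasticSet n = (⋂ i, ⋂ j, {X | 0 ≤ X.1 i j}) ∩ ⋂ i, {X | ∑ j, X.1 i j = 1} := by
    ext X
    simp [mem_rowStochasticSet]
  have hc : ∀ i j, Continuous fun X : FullSpace n n => X.1 i j := fun i j =>
    continuous_subtype_val.matrix_elem i j
  rw [h]
  exact (isClosed_iInter fun i => isClosed_iInter fun j =>
    isClosed_le continuous_const (hc i j)).inter (isClosed_iInter fun i => isClosed_eq (continuous_finsetSum _ fun j _ => hc i j)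
      continuous_const)

theorem isClosed_doublyStochasticSet : IsClosed (doublyStochasticSet n) := by
  have h : doublyStochasticSet n = rowStochasticSet n ∩ ⋂ j, {X | ∑ i, X.1 i j = 1} := by
    ext X
    simp [mem_doublyStochasticSet]
  rw [h]
  exact isClosed_rowStochasticSet.inter (isClosed_iInter fun j =>
    isClosed_eq (continuous_finsetSum _ fun i _ => continuous_subtype_val.matrix_elem i j)
      continuous_const)

theorem convex_rowStochasticSet : Convex ℝ (rowStochasticSet n) := by
  intro X hX Y hY a b ha hb hab
  rw [mem_rowStochasticSet] at hX hY ⊢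
  have h : ∀ i j, (a • X + b • Y).1 i j = a * X.1 i j + b * Y.1 i j := fun i j => rfl
  simp only [h]
  refine ⟨fun i j => ?_, fun i => ?_⟩
  · have := hX.1 i j
    have := hY.1 i j
    positivity
  · rw [Finset.sum_add_distrib, ← Finset.mul_sum, ← Finset.mul_sum, hX.2, hY.2]
    linarith

theorem convex_doublyStochasticSet : Convex ℝ (doublyStochasticSet n) := by
  intro X hX Y hY a b ha hb hab
  rw [mem_doublyStochasticSet] at hX hY ⊢
  refine ⟨convex_rowStochasticSet hX.1 hY.1 ha hb hab, fun j => ?_⟩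
  have h : ∀ i j, (a • X + b • Y).1 i j = a * X.1 i j + b * Y.1 i j := fun i j => rfl
  simp only [h]
  rw [Finset.sum_add_distrib, ← Finset.mul_sum, ← Finset.mul_sum, hX.2, hY.2]
  linarith

/-- If `X e = e`, then `Xᵀ V = 0` forces the column sums of `V` to vanish. -/
theorem sum_col_eq_zero {X V : FullSpace n n} (hX : ∀ i, ∑ j, X.1 i j = 1)
    (hXV : X.1ᵀ * V.1 = 0) (j : Fin n) : ∑ i, V.1 i j = 0 := by
  have h : ∀ k, ∑ i, X.1 i k * V.1 i j = 0 := fun k => congrFun (congrFun hXV k) j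
  calc ∑ i, V.1 i j = ∑ i, (∑ k, X.1 i k) * V.1 i j := by simp [hX]
    _ = ∑ k, ∑ i, X.1 i k * V.1 i j := by
        rw [Finset.sum_comm]; simp only [Finset.sum_mul]
    _ = 0 := Finset.sum_eq_zero fun k _ => h k

theorem firstCriterion_and_calm_rowStochasticSet {r : ℕ} (hrn : r ≤ n) (hn : 0 < n) :
    FirstCriterion (rowStochasticSet n) r ∧ PerturbationCalm (rowStochasticSet n) r := by
  refine firstCriterion_and_calm hrn isClosed_rowStochasticSet
    (exists_mem_rankSet_fullSpace_norm_sub_le hrn le_rfl) fun X hX V hV hV' => ?_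
  obtain ⟨hVX, hXV⟩ := mul_transpose_eq_zero_of_mem_normalCone_rankSet hV'
  have hX1 := (mem_rowStochasticSet.1 hX).2
  have hpos : ∀ Z ∈ rowStochasticSet n, 0 ≤ inner ℝ V Z := fun Z hZ => by
    have h1 := inner_sub_nonpos_of_mem_limitingNormalCone convex_rowStochasticSet hV hZ
    rw [inner_neg_left, inner_sub_right, inner_eq_zero_of_mem_normalCone_rankSet hV'] at h1
    linarith
  have hn' : (n : ℝ) ≠ 0 := by positivity
  -- `W` is the part of `V` with zero row sums, so that `V = W + y eᵀ`
  let y : Fin n → ℝ := fun i => (∑ j, V.1 i j) / n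
  let W : FullSpace n n := ⟨Matrix.of fun i j => V.1 i j - y i, trivial⟩
  have hW : ∀ i j, W.1 i j = V.1 i j - y i := fun i j => rfl
  have hWrow : ∀ i, ∑ j, W.1 i j = 0 := fun i => by
    simp only [hW, Finset.sum_sub_distrib, Finset.sum_const, Finset.card_univ, Fintype.card_fin,
      nsmul_eq_mul, y]
    field_simp
    ring
  have h1 : inner ℝ V W ≤ 0 := inner_nonpos_of_barycentre hn (sum_col_eq_zero hX1 hXV) hpos
    fun t ht => mem_rowStochasticSet.2 ⟨ht, fun i => by
      change ∑ j, ((1 : ℝ) / n - t * W.1 i j) = 1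
      rw [Finset.sum_sub_distrib, ← Finset.mul_sum, hWrow]
      simp [hn']⟩
  have h2 : inner ℝ V W = inner ℝ W W := by
    rw [inner_eq_sum, inner_eq_sum]
    refine Finset.sum_congr rfl fun i _ => ?_
    have : ∑ j, V.1 i j * W.1 i j = ∑ j, (W.1 i j * W.1 i j + y i * W.1 i j) :=
      Finset.sum_congr rfl fun j _ => by rw [hW]; ring
    rw [this, Finset.sum_add_distrib, ← Finset.mul_sum, hWrow, mul_zero, add_zero]
  have hW0 : W = 0 := eq_zero_of_inner_self_nonpos (h2 ▸ h1)
  have hVy : ∀ i j, V.1 i j = y i := fun i j => by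
    have : W.1 i j = 0 := by rw [hW0]; rfl
    rw [hW] at this
    linarith
  -- `V = y eᵀ` and `X e = e` give `V Xᵀ = y eᵀ`, hence `y = 0`
  apply Subtype.ext
  ext i j
  have h3 : ∑ k, V.1 i k * X.1 i k = 0 := congrFun (congrFun hVX i) i
  simp only [hVy] at h3
  rw [← Finset.mul_sum, hX1, mul_one] at h3
  rw [hVy, h3]
  rfl

theorem firstCriterion_and_calm_doublyStochasticSet {r : ℕ} (hrn : r ≤ n) (hn : 0 < n) :
    FirstCriterion (doublyStochasticSet n) r ∧ PerturbationCalm (doublyStochasticSet n) r := by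
  refine firstCriterion_and_calm hrn isClosed_doublyStochasticSet
    (exists_mem_rankSet_fullSpace_norm_sub_le hrn le_rfl) fun X hX V hV hV' => ?_
  obtain ⟨hVX, hXV⟩ := mul_transpose_eq_zero_of_mem_normalCone_rankSet hV'
  obtain ⟨hX1, hX2⟩ := mem_doublyStochasticSet.1 hX
  have hpos : ∀ Z ∈ doublyStochasticSet n, 0 ≤ inner ℝ V Z := fun Z hZ => by
    have h1 := inner_sub_nonpos_of_mem_limitingNormalCone convex_doublyStochasticSet hV hZ
    rw [inner_neg_left, inner_sub_right, inner_eq_zero_of_mem_normalCone_rankSet hV'] at h1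
    linarith
  have hn' : (n : ℝ) ≠ 0 := by positivity
  have hcol := sum_col_eq_zero (mem_rowStochasticSet.1 hX1).2 hXV
  -- the row sums of `V` are the column sums of `Vᵀ`, and `Xᵀ` is row-stochastic as well
  have hrow : ∀ i, ∑ j, V.1 i j = 0 :=
    sum_col_eq_zero (X := ⟨X.1ᵀ, trivial⟩) (V := ⟨V.1ᵀ, trivial⟩) hX2 <| by
      change X.1ᵀᵀ * V.1ᵀ = 0
      rw [← Matrix.transpose_mul, hVX, Matrix.transpose_zero]
  have h1 : inner ℝ V V ≤ 0 := inner_nonpos_of_barycentre hn hcol hpos fun t ht =>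
    mem_doublyStochasticSet.2 ⟨mem_rowStochasticSet.2 ⟨ht, fun i => by
      change ∑ j, ((1 : ℝ) / n - t * V.1 i j) = 1
      rw [Finset.sum_sub_distrib, ← Finset.mul_sum, hrow]
      simp [hn']⟩, fun j => by
      change ∑ i, ((1 : ℝ) / n - t * V.1 i j) = 1
      rw [Finset.sum_sub_distrib, ← Finset.mul_sum, hcol]
      simp [hn']⟩
  exact eq_zero_of_inner_self_nonpos h1

end Stochastic

end RankCalm

theorem mainTheorem8 (n r : ℕ) (hr : 1 ≤ r) (hrn : r ≤ n) :
    -- norm balls and Frobenius spheres in `ℝ^{n×m}`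
    (∀ (m : ℕ), n ≤ m → ∀ ϱ : ℝ, 0 < ϱ →
      (∀ p : Seminorm ℝ (FullSpace n m), (∀ Z, p Z = 0 → Z = 0) →
        FirstCriterion (normBall p ϱ) r ∧ PerturbationCalm (normBall p ϱ) r) ∧
      FirstCriterion (frobeniusSphere (FullSpace n m) ϱ) r ∧
      PerturbationCalm (frobeniusSphere (FullSpace n m) ϱ) r) ∧
    -- norm balls and Frobenius spheres in `𝕊ⁿ`, and norm balls intersected with `𝕊ⁿ₊`
    (∀ ϱ : ℝ, 0 < ϱ →
      (∀ p : Seminorm ℝ (SymSpace n), (∀ Z, p Z = 0 → Z = 0) →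
        FirstCriterion (normBall p ϱ) r ∧ PerturbationCalm (normBall p ϱ) r ∧
        SecondCriterion (normBall p ϱ) r ∧ PerturbationCalm (psdCone n ∩ normBall p ϱ) r) ∧
      FirstCriterion (frobeniusSphere (SymSpace n) ϱ) r ∧
      PerturbationCalm (frobeniusSphere (SymSpace n) ϱ) r) ∧
    -- the elliptope
    (SecondCriterion (unitDiagonalSet n) r ∧
      PerturbationCalm (psdCone n ∩ unitDiagonalSet n) r) ∧
    -- two affine constraints
    (∀ (b₁ b₂ : ℝ) (B C : SymSpace n), b₂ ≠ 0 → IsUnit (B.1 - (b₁ / b₂) • C.1) →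
      SecondCriterion (traceHyperplane B b₁ ∩ traceHyperplane C b₂) r ∧
      PerturbationCalm (psdCone n ∩ (traceHyperplane B b₁ ∩ traceHyperplane C b₂)) r) ∧
    -- one affine constraint
    (∀ (b₂ : ℝ) (C : SymSpace n), b₂ ≠ 0 → IsUnit C.1 →
      SecondCriterion (traceHyperplane C b₂) r ∧
      PerturbationCalm (psdCone n ∩ traceHyperplane C b₂) r) ∧
    -- the lifting of 0-1 quadratic programs
    (SecondCriterion (zeroOneSet n (Nat.lt_of_lt_of_le hr hrn)) r ∧
      PerturbationCalm (psdCone n ∩ zeroOneSet n (Nat.lt_of_lt_of_le hr hrn)) r) ∧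
    -- block orthogonality constraints
    (∀ (k p : ℕ) (h : k * p = n),
      SecondCriterion (blockOrthogonalSet h) r ∧
      PerturbationCalm (psdCone n ∩ blockOrthogonalSet h) r) ∧
    -- row-stochastic matrices
    (FirstCriterion (rowStochasticSet n) r ∧ PerturbationCalm (rowStochasticSet n) r) ∧
    -- doubly stochastic matrices
    (FirstCriterion (doublyStochasticSet n) r ∧ PerturbationCalm (doublyStochasticSet n) r) := by
  have hn : 0 < n := Nat.lt_of_lt_of_le hr hrn
  have htrunc : ∀ X : SymSpace n, ∃ Z ∈ rankSet (SymSpace n) r,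
      ‖X - Z‖ ≤ 2 * (nuclearNorm X.1 - kyFanNorm r X.1) := fun X =>
    let ⟨Z, hZ, _, hXZ⟩ := exists_mem_rankSet_symSpace_norm_sub_le hrn X
    ⟨Z, hZ, hXZ⟩
  refine ⟨fun m hnm ϱ hϱ => ⟨fun p _ => ?_, ?_⟩, fun ϱ hϱ => ⟨fun p _ => ?_, ?_⟩,
    secondCriterion_and_calm_unitDiagonalSet hrn,
    fun b₁ b₂ B C hb₂ hBC => secondCriterion_and_calm_traceHyperplane_inter hrn hb₂ hBC,
    fun b₂ C hb₂ _ => secondCriterion_and_calm_traceHyperplane hrn hb₂,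
    secondCriterion_and_calm_zeroOneSet hrn hn,
    fun k p h => secondCriterion_and_calm_blockOrthogonalSet hrn hn h,
    firstCriterion_and_calm_rowStochasticSet hrn hn,
    firstCriterion_and_calm_doublyStochasticSet hrn hn⟩
  · exact firstCriterion_and_calm_normBall hrn
      (exists_mem_rankSet_fullSpace_norm_sub_le hrn hnm) p hϱ
  · exact firstCriterion_and_calm_frobeniusSphere hrn
      (exists_mem_rankSet_fullSpace_norm_sub_le hrn hnm) hϱ
  · have h1 := firstCriterion_and_calm_normBall hrn htrunc p hϱ
    exact ⟨h1.1, h1.2, secondCriterion_and_calm_normBall hrn p hϱ⟩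
  · exact firstCriterion_and_calm_frobeniusSphere hrn htrunc hϱ
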